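/- Let $n\in\mathbb{N}$, let $A(x)$ be a $\mathbb{Z}^n$-periodic symmetric positive definite $n\times n$ matrix depending smoothly on $x\in\mathbb{R}^n$, let $V:\mathbb{R}^n\to\mathbb{R}$ be smooth and $\mathbb{Z}^n$-periodic, and put $H(x,p)=\tfrac12\langle A(x)p,p\rangle+V(x)$. For a function $w$ on $\mathbb{R}^n$ let $$D^+w(x)=\Big\{p\in\mathbb{R}^n:\limsup_{y\to x}\tfrac{w(y)-w(x)-\langle p,y-x\rangle}{|y-x|}\le 0\Big\},\qquad D^-w(x)=\Big\{p\in\mathbb{R}^n:\liminf_{y\to x}\tfrac{w(y)-w(x)-\langle p,y-x\rangle}{|y-x|}\ge 0\Big\},$$ and let $\Sigma_w$ be the set of points $x$ at which $D^+w(x)$ is not a singleton. For $c\in\mathbb{R}^n$ and $E\in\mathbb{R}$, a $\mathbb{Z}^n$-periodic viscosity solution of $H(x,c+Du(x))=E$ is a continuous $\mathbb{Z}^n$-periodic $u:\mathbb{R}^n\to\mathbb{R}$ such that, for every $x$, $H(x,c+p)\le E$ for all $p\in D^+u(x)$ and $H(x,c+p)\ge E$ for all $p\in D^-u(x)$; $\alpha(c)$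 denotes the unique $E$ for which such a solution exists (Mather's $\alpha$-function). Let $u$ be a $\mathbb{Z}^n$-periodic viscosity solution of $H(x,c+Du(x))=\alpha(c)$, assume $\alpha(c)>\max_{x}V(x)$, and set $v(x)=u(x)+\langle c,x\rangle$. A singular generalized characteristic starting at $x\in\mathbb{R}^n$ is a Lipschitz arc $\mathbf{x}:[0,\tau]\to\mathbb{R}^n$, $\tau>0$, with $\mathbf{x}(0)=x$, with $\mathbf{x}(s)\in\Sigma_v$ for all $s\in[0,\tau]$, and such that $$\dot{\mathbf{x}}(s)\in\overline{\mathrm{co}}\,H_p\big(\mathbf{x}(s),D^+v(\mathbf{x}(s))\big)\quad\text{for a.e. }s\in[0,\tau],$$ where $\overline{\mathrm{co}}$ is the closed convex hull and $H_p$ the gradient of $H$ in $p$. Then for every $x\in\Sigma_v$: $0\notin D^+v(x)$ if and only if there is a singular generalized characteristic $\mathbf{x}$ starting at $x$ whose right derivative $\dot{\mathbf{x}}^+(0)$ exists and is nonzero. -/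

import Mathlib

open Set Filter Topology MeasureTheory
open scoped ContDiff NNReal

namespace WeakKAM

/-- The Dini superdifferential `D⁺u(x)`: the vectors `p` with
`limsup_{y → x} (u y - u x - ⟨p, y - x⟩) / |y - x| ≤ 0`. -/
def superdiff {n : ℕ} (u : EuclideanSpace ℝ (Fin n) → ℝ) (x : EuclideanSpace ℝ (Fin n)) :
    Set (EuclideanSpace ℝ (Fin n)) :=
  {p | ∀ ε : ℝ, 0 < ε → ∀ᶠ y in 𝓝 x, u y - u x - inner ℝ p (y - x) ≤ ε * ‖y - x‖}

/-- The Dini subdifferential `D⁻u(x)`: the vectors `p` with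
`liminf_{y → x} (u y - u x - ⟨p, y - x⟩) / |y - x| ≥ 0`. -/
def subdiff {n : ℕ} (u : EuclideanSpace ℝ (Fin n) → ℝ) (x : EuclideanSpace ℝ (Fin n)) :
    Set (EuclideanSpace ℝ (Fin n)) :=
  {p | ∀ ε : ℝ, 0 < ε → ∀ᶠ y in 𝓝 x, -(ε * ‖y - x‖) ≤ u y - u x - inner ℝ p (y - x)}

/-- The singular set `Σ_u`: the points at which `D⁺u` is not a singleton. -/
def singularSet {n : ℕ} (u : EuclideanSpace ℝ (Fin n) → ℝ) : Set (EuclideanSpace ℝ (Fin n)) :=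
  {x | ¬ ∃ p, superdiff u x = {p}}

/-- `ℤⁿ`-periodicity of a function on `ℝⁿ`. -/
def ZPeriodic {n : ℕ} {β : Type*} (f : EuclideanSpace ℝ (Fin n) → β) : Prop :=
  ∀ (k : Fin n → ℤ) (x : EuclideanSpace ℝ (Fin n)),
    f (x + WithLp.toLp 2 (fun i => (k i : ℝ))) = f x

/-- The mechanical Hamiltonian `H(x, p) = ½ ⟨A(x) p, p⟩ + V(x)`. -/
noncomputable def mechHamiltonian {n : ℕ}
    (A : EuclideanSpace ℝ (Fin n) → Matrix (Fin n) (Fin n) ℝ)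
    (V : EuclideanSpace ℝ (Fin n) → ℝ) (x p : EuclideanSpace ℝ (Fin n)) : ℝ :=
  1 / 2 * inner ℝ (Matrix.toEuclideanLin (A x) p) p + V x

/-- `u` is a continuous `ℤⁿ`-periodic viscosity solution of `H(x, c + Du(x)) = E`. -/
structure IsPeriodicViscositySolution {n : ℕ}
    (H : EuclideanSpace ℝ (Fin n) → EuclideanSpace ℝ (Fin n) → ℝ)
    (c : EuclideanSpace ℝ (Fin n)) (E : ℝ) (u : EuclideanSpace ℝ (Fin n) → ℝ) : Prop where
  continuous : Continuous u
  periodic : ZPeriodic u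
  subsolution : ∀ x, ∀ p ∈ superdiff u x, H x (c + p) ≤ E
  supersolution : ∀ x, ∀ p ∈ subdiff u x, E ≤ H x (c + p)

/-- Mather's function `α(c)`: the unique constant `E` for which `H(x, c + Du(x)) = E` has a
`ℤⁿ`-periodic viscosity solution. The set below has exactly one element for the Hamiltonians
considered here, and `sInf` picks it. -/
noncomputable def matherAlpha {n : ℕ}
    (H : EuclideanSpace ℝ (Fin n) → EuclideanSpace ℝ (Fin n) → ℝ)
    (c : EuclideanSpace ℝ (Fin n)) : ℝ :=
  sInf {E : ℝ | ∃ u, IsPeriodicViscositySolution H c E u}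

/-- The arc `ξ : [0, τ] → ℝⁿ` (only the values on `[0, τ]` matter) is a generalized
characteristic of `H(x, Du(x)) = const`: it is Lipschitz and, for a.e. `s ∈ [0, τ]`,
`ξ'(s)` exists and lies in the closed convex hull of `H_p(ξ(s), D⁺u(ξ(s)))`. -/
structure IsGeneralizedCharacteristic {n : ℕ}
    (H : EuclideanSpace ℝ (Fin n) → EuclideanSpace ℝ (Fin n) → ℝ)
    (u : EuclideanSpace ℝ (Fin n) → ℝ) (τ : ℝ) (ξ : ℝ → EuclideanSpace ℝ (Fin n)) : Prop where
  lipschitz : ∃ K : ℝ≥0, LipschitzOnWith K ξ (Icc 0 τ)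
  inclusion : ∀ᵐ s ∂(volume.restrict (Icc (0 : ℝ) τ)),
    ∃ w ∈ closure (convexHull ℝ ((fun p => gradient (H (ξ s)) p) '' superdiff u (ξ s))),
      HasDerivAt ξ w s

/-- A singular generalized characteristic: one that stays in the singular set `Σ_u`. -/
structure IsSingularGeneralizedCharacteristic {n : ℕ}
    (H : EuclideanSpace ℝ (Fin n) → EuclideanSpace ℝ (Fin n) → ℝ)
    (u : EuclideanSpace ℝ (Fin n) → ℝ) (τ : ℝ) (ξ : ℝ → EuclideanSpace ℝ (Fin n)) : Prop
    extends IsGeneralizedCharacteristic H u τ ξ where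
  singular : ∀ s ∈ Icc (0 : ℝ) τ, ξ s ∈ singularSet u

end WeakKAM

/-! The function v is Lipschitz and semiconcave with linear modulus: D⁺v(x) is nonempty, convex and
compact, and ⟨p - q, x - y⟩ ≤ 2C|x - y|² for supergradients p at x and q at y. Since H is quadratic
in p, the convex hull in the definition is redundant and generalized characteristics solve ξ' ∈ A(ξ)
D⁺v(ξ) almost everywhere (`EllipticPair.mem_closure_convexHull_iff`). In the metric A⁻¹ the
inequality above acts as a one-sided Lipschitz condition, so solutions can be compared forward in
time.

Semiconcavity itself comes from maximizing a penalized second difference of v and using the equation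
at the three points of the maximum (`EllipticField.midpoint_semiconcave`).

If 0 ∈ D⁺v(x₀), comparison with the constant arc gives ⟨A(x₀)⁻¹(ξ - x₀), ξ - x₀⟩ = O(t³), so a right
derivative at 0 must vanish (`EllipticPair.eq_zero_of_zero_mem_superdiff`).

If 0 ∉ D⁺v(x₀), a limit of Euler polygons yields an arc
(`EllipticPair.exists_forwardCharacteristic`) whose right derivative at 0 is A(x₀)p₀, with p₀ the
supergradient of least energy (`IsForwardCharacteristic.tendsto_slope_zero`); it is nonzero since p₀
≠ 0. At a singular point strict convexity gives H(x₀, p₀) < α(c) (`EllipticField.min_energy_lt`).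
Comparing ξ with its own time shifts bounds the growth of its kinetic energy by O(t)
(`IsForwardCharacteristic.energy_le`). At a regular point the unique supergradient is also a
subgradient, so its energy is at least α(c), and by upper semicontinuity of D⁺v the velocities just
afterwards would nearly have that energy. For small t this is impossible, so ξ stays singular. -/

namespace WeakKAM

/-! ### Monotonicity along Lipschitz arcs and second differences. -/

section Calculus

/-- A Lipschitz function whose derivative is a.e. nonpositive does not increase. -/
theorem le_of_ae_hasDerivAt_nonpos {f : ℝ → ℝ} {a b : ℝ} {K : ℝ≥0} (hab : a ≤ b)
    (hf : LipschitzOnWith K f (Icc a b))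
    (h : ∀ᵐ s, s ∈ Ioo a b → ∃ d ≤ 0, HasDerivAt f d s) : f b ≤ f a := by
  -- Absolute continuity makes the increment the integral of the derivative, so a null set of bad
  -- times is harmless.
  have hac : AbsolutelyContinuousOnInterval f a b := by
    apply LipschitzOnWith.absolutelyContinuousOnInterval
    rwa [uIcc_of_le hab]
  have h1 := hac.integral_deriv_eq_sub
  have h2 : ∫ x in a..b, deriv f x ≤ 0 := by
    rw [intervalIntegral.integral_of_le hab, integral_Ioc_eq_integral_Ioo]
    apply integral_nonpos_of_ae
    rw [EventuallyLE, ae_restrict_iff' measurableSet_Ioo]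
    filter_upwards [h] with s hs hsm
    obtain ⟨d, hd, hd'⟩ := hs hsm
    rw [hd'.deriv]
    exact hd
  linarith

/-- A C¹ function is only locally Lipschitz, but the arc has compact image. This supplies the
Lipschitz hypothesis of `le_of_ae_hasDerivAt_nonpos` for the functionals, quadratic in the arc, used
below. -/
theorem exists_lipschitzOnWith_comp {F : Type*} [NormedAddCommGroup F] [NormedSpace ℝ F]
    {g : F → ℝ} (hg : ContDiff ℝ 1 g) {f : ℝ → F} {a b : ℝ} {K : ℝ≥0}
    (hf : LipschitzOnWith K f (Icc a b)) : ∃ K', LipschitzOnWith K' (fun s => g (f s)) (Icc a b) := by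
  have hc : IsCompact (f '' Icc a b) := isCompact_Icc.image_of_continuousOn hf.continuousOn
  obtain ⟨K', hK'⟩ := LocallyLipschitzOn.exists_lipschitzOnWith_of_compact hc
    (hg.locallyLipschitz.locallyLipschitzOn (s := f '' Icc a b))
  exact ⟨K' * K, hK'.comp hf (mapsTo_image _ _)⟩

/-- A function whose derivative is Lipschitz has second differences of quadratic size. -/
theorem norm_second_difference_le {E F : Type*} [NormedAddCommGroup E] [NormedSpace ℝ E]
    [NormedAddCommGroup F] [NormedSpace ℝ F] {f : E → F} {L : ℝ}
    (hf : Differentiable ℝ f) (hf' : ∀ x y, ‖fderiv ℝ f x - fderiv ℝ f y‖ ≤ L * ‖x - y‖)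
    (hL : ∀ x y, ‖f x - f y‖ ≤ L * ‖x - y‖) (hL0 : 0 ≤ L) (x y z : E) :
    ‖f x + f y - (2 : ℝ) • f z‖ ≤ L * (‖x - y‖ ^ 2 + ‖x + y - (2 : ℝ) • z‖) := by
  -- Expanding at the midpoint makes the first-order terms at x and y cancel; moving from m to z
  -- costs only the Lipschitz bound.
  set m : E := (2⁻¹ : ℝ) • (x + y) with hm
  have key : ∀ w : E, ‖f w - f m - fderiv ℝ f m (w - m)‖ ≤ L * ‖w - m‖ * ‖w - m‖ := by
    intro w
    refine (convex_closedBall m ‖w - m‖).norm_image_sub_le_of_norm_fderiv_le'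
      (fun t _ => hf t) (fun t ht => ?_) (by simp) (by simp [dist_eq_norm])
    refine (hf' t m).trans ?_
    rw [mem_closedBall_iff_norm] at ht
    gcongr
  have hx : x - m = (2⁻¹ : ℝ) • (x - y) := by rw [hm]; module
  have hy : y - m = -((2⁻¹ : ℝ) • (x - y)) := by rw [hm]; module
  have hz : m - z = (2⁻¹ : ℝ) • (x + y - (2 : ℝ) • z) := by rw [hm]; module
  have h1 := key x
  have h2 := key y
  have h3 := hL m z
  rw [hx] at h1
  rw [hy, map_neg] at h2
  rw [hz] at h3
  rw [norm_neg] at h2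
  rw [norm_smul, Real.norm_of_nonneg (by norm_num)] at h1 h2 h3
  have e : f x + f y - (2 : ℝ) • f z =
      (f x - f m - fderiv ℝ f m ((2⁻¹ : ℝ) • (x - y))) +
      (f y - f m - -fderiv ℝ f m ((2⁻¹ : ℝ) • (x - y))) + (2 : ℝ) • (f m - f z) := by module
  rw [e]
  refine (norm_add₃_le).trans ?_
  rw [norm_smul, Real.norm_of_nonneg (by norm_num : (0:ℝ) ≤ 2)]
  have : 0 ≤ L * ‖x - y‖ ^ 2 := by positivity
  nlinarith

end Calculus

/-! ### Uniform constants from periodicity and compactness. -/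

section Periodic

variable {n : ℕ}

/-- A compact fundamental domain for the translations by `ℤⁿ`. -/
theorem exists_compact_fundamental_domain (n : ℕ) :
    ∃ S : Set (EuclideanSpace ℝ (Fin n)), IsCompact S ∧
      ∀ x, ∃ k : Fin n → ℤ, x + WithLp.toLp 2 (fun i => (k i : ℝ)) ∈ S := by
  refine ⟨WithLp.toLp 2 '' (Set.pi univ fun _ => Icc (0 : ℝ) 1),
    (isCompact_univ_pi fun _ => isCompact_Icc).image (PiLp.continuous_toLp 2 _), fun x => ?_⟩
  refine ⟨fun i => -⌊x i⌋, fun i => Int.fract (x i),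
    fun i _ => ⟨Int.fract_nonneg _, (Int.fract_lt_one _).le⟩, ?_⟩
  ext i
  simp [Int.fract, sub_eq_add_neg]

theorem ZPeriodic.exists_bound {F : Type*} [NormedAddCommGroup F]
    {f : EuclideanSpace ℝ (Fin n) → F} (hp : ZPeriodic f) (hf : Continuous f) :
    ∃ M, 0 ≤ M ∧ ∀ x, ‖f x‖ ≤ M := by
  obtain ⟨S, hS, hk⟩ := exists_compact_fundamental_domain n
  obtain ⟨M, hM⟩ := hS.exists_bound_of_continuousOn hf.continuousOn
  refine ⟨max M 0, le_max_right _ _, fun x => ?_⟩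
  obtain ⟨k, hx⟩ := hk x
  rw [← hp k x]
  exact (hM _ hx).trans (le_max_left _ _)

theorem ZPeriodic.fderiv {F : Type*} [NormedAddCommGroup F] [NormedSpace ℝ F]
    {f : EuclideanSpace ℝ (Fin n) → F} (hp : ZPeriodic f) : ZPeriodic (fderiv ℝ f) := by
  intro k x
  rw [← fderiv_comp_add_right]
  congr 1
  exact funext (hp k)

theorem ZPeriodic.exists_lipschitz {F : Type*} [NormedAddCommGroup F] [NormedSpace ℝ F]
    {f : EuclideanSpace ℝ (Fin n) → F} (hp : ZPeriodic f) (hf : ContDiff ℝ 1 f) :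
    ∃ L, 0 ≤ L ∧ ∀ x y, ‖f x - f y‖ ≤ L * ‖x - y‖ := by
  obtain ⟨M, hM0, hM⟩ := hp.fderiv.exists_bound (hf.continuous_fderiv one_ne_zero)
  exact ⟨M, hM0, fun x y => convex_univ.norm_image_sub_le_of_norm_fderiv_le
    (fun t _ => hf.differentiable one_ne_zero t) (fun t _ => hM t) (mem_univ y) (mem_univ x)⟩

theorem ZPeriodic.exists_second_difference {F : Type*} [NormedAddCommGroup F] [NormedSpace ℝ F]
    {f : EuclideanSpace ℝ (Fin n) → F} (hp : ZPeriodic f) (hf : ContDiff ℝ 2 f) :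
    ∃ L, 0 ≤ L ∧ (∀ x y, ‖f x - f y‖ ≤ L * ‖x - y‖) ∧
      ∀ x y z, ‖f x + f y - (2 : ℝ) • f z‖ ≤ L * (‖x - y‖ ^ 2 + ‖x + y - (2 : ℝ) • z‖) := by
  obtain ⟨L₁, h₁, h₁'⟩ := hp.exists_lipschitz (hf.of_le (by norm_num))
  obtain ⟨L₂, h₂, h₂'⟩ := hp.fderiv.exists_lipschitz (hf.fderiv_right (m := 1) (by norm_num))
  have hL : ∀ x y, ‖f x - f y‖ ≤ max L₁ L₂ * ‖x - y‖ := fun x y =>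
    (h₁' x y).trans (by gcongr; exact le_max_left _ _)
  refine ⟨max L₁ L₂, h₁.trans (le_max_left _ _), hL, norm_second_difference_le
    (hf.differentiable (by norm_num)) (fun x y => (h₂' x y).trans ?_) hL
    (h₁.trans (le_max_left _ _))⟩
  gcongr
  exact le_max_right _ _

theorem ZPeriodic.exists_coercive
    {a : EuclideanSpace ℝ (Fin n) → EuclideanSpace ℝ (Fin n) →L[ℝ] EuclideanSpace ℝ (Fin n)}
    (hp : ZPeriodic a) (hc : Continuous a) (hpos : ∀ x p, p ≠ 0 → 0 < inner ℝ (a x p) p) :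
    ∃ l > 0, ∀ x p, l * ‖p‖ ^ 2 ≤ inner ℝ (a x p) p := by
  obtain ⟨S, hS, hk⟩ := exists_compact_fundamental_domain n
  have hK : IsCompact (S ×ˢ Metric.sphere (0 : EuclideanSpace ℝ (Fin n)) 1) :=
    hS.prod (isCompact_sphere 0 1)
  have hcont : Continuous fun z : EuclideanSpace ℝ (Fin n) × EuclideanSpace ℝ (Fin n) =>
      inner ℝ (a z.1 z.2) z.2 := by fun_prop
  obtain ⟨l, hl, hl'⟩ : ∃ l > 0, ∀ x ∈ S, ∀ p ∈ Metric.sphere (0 : EuclideanSpace ℝ (Fin n)) 1,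
      l ≤ inner ℝ (a x p) p := by
    -- For n = 0 the unit sphere is empty and any positive constant serves.
    rcases (S ×ˢ Metric.sphere (0 : EuclideanSpace ℝ (Fin n)) 1).eq_empty_or_nonempty with h | h
    · refine ⟨1, one_pos, fun x hx p hp => ?_⟩
      have hxp : (x, p) ∈ S ×ˢ Metric.sphere (0 : EuclideanSpace ℝ (Fin n)) 1 := ⟨hx, hp⟩
      rw [h] at hxp
      exact absurd hxp (notMem_empty _)
    · obtain ⟨z, hz, hmin⟩ := hK.exists_isMinOn h hcont.continuousOn
      refine ⟨_, hpos z.1 z.2 ?_, fun x hx p hp => hmin (show (x, p) ∈ _ from ⟨hx, hp⟩)⟩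
      rintro h0
      have := hz.2
      simp [h0] at this
  refine ⟨l, hl, fun x p => ?_⟩
  rcases eq_or_ne p 0 with rfl | h0
  · simp
  obtain ⟨k, hx⟩ := hk x
  have := hl' _ hx ((‖p‖⁻¹) • p) (by simp [norm_smul, h0])
  rw [hp k x, map_smul, inner_smul_left, inner_smul_right] at this
  have h1 : 0 < ‖p‖ := norm_pos_iff.2 h0
  simp only [conj_trivial] at this
  rw [← mul_assoc, ← sq, inv_pow, inv_mul_eq_div, le_div_iff₀ (by positivity)] at this
  exact this

end Periodic

end WeakKAM

/-! ### A priori estimates for the viscosity solution: Lipschitz bound and semiconcavity. -/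

namespace WeakKAM

variable {n : ℕ}

/-- Uniform bounds on a field of symmetric positive definite operators: ellipticity, boundedness,
Lipschitz continuity, and second differences of quadratic size. -/
structure EllipticField
    (a : EuclideanSpace ℝ (Fin n) → EuclideanSpace ℝ (Fin n) →L[ℝ] EuclideanSpace ℝ (Fin n))
    (l M L : ℝ) : Prop where
  l_pos : 0 < l
  M_nonneg : 0 ≤ M
  L_nonneg : 0 ≤ L
  symm : ∀ x p q, inner ℝ (a x p) q = inner ℝ p (a x q)
  coercive : ∀ x p, l * ‖p‖ ^ 2 ≤ inner ℝ (a x p) p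
  bound : ∀ x, ‖a x‖ ≤ M
  lipschitz : ∀ x y, ‖a x - a y‖ ≤ L * ‖x - y‖
  second_difference : ∀ x y z,
    ‖a x + a y - (2 : ℝ) • a z‖ ≤ L * (‖x - y‖ ^ 2 + ‖x + y - (2 : ℝ) • z‖)

section Differentials

variable {v : EuclideanSpace ℝ (Fin n) → ℝ} {x p : EuclideanSpace ℝ (Fin n)}

theorem eventually_sq_le {ε : ℝ} (hε : 0 < ε) (C : ℝ) (x : EuclideanSpace ℝ (Fin n)) :
    ∀ᶠ y in 𝓝 x, C * ‖y - x‖ ^ 2 ≤ ε * ‖y - x‖ := by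
  have h : Tendsto (fun y => C * ‖y - x‖) (𝓝 x) (𝓝 0) := by
    have : Continuous fun y => C * ‖y - x‖ := by fun_prop
    simpa using this.tendsto x
  filter_upwards [h.eventually (Iio_mem_nhds hε)] with y hy
  rw [sq, ← mul_assoc]
  exact mul_le_mul_of_nonneg_right (le_of_lt hy) (norm_nonneg _)

theorem mem_superdiff_of_quadratic {C : ℝ}
    (h : ∀ y, v y ≤ v x + inner ℝ p (y - x) + C * ‖y - x‖ ^ 2) : p ∈ superdiff v x := by
  intro ε hε
  filter_upwards [eventually_sq_le hε C x] with y hy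
  linarith [h y]

theorem mem_subdiff_of_quadratic {C : ℝ}
    (h : ∀ y, v x + inner ℝ p (y - x) - C * ‖y - x‖ ^ 2 ≤ v y) : p ∈ subdiff v x := by
  intro ε hε
  filter_upwards [eventually_sq_le hε C x] with y hy
  linarith [h y]

theorem mem_superdiff_iff_sub_mem {u : EuclideanSpace ℝ (Fin n) → ℝ}
    {c : EuclideanSpace ℝ (Fin n)} (hv : ∀ x, v x = u x + inner ℝ c x) :
    p ∈ superdiff v x ↔ p - c ∈ superdiff u x := by
  have : ∀ y, v y - v x - inner ℝ p (y - x) = u y - u x - inner ℝ (p - c) (y - x) := by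
    intro y
    rw [hv, hv, inner_sub_left, inner_sub_right c]
    ring
  simp only [superdiff, mem_ofPred_eq, this]

theorem mem_subdiff_iff_sub_mem {u : EuclideanSpace ℝ (Fin n) → ℝ}
    {c : EuclideanSpace ℝ (Fin n)} (hv : ∀ x, v x = u x + inner ℝ c x) :
    p ∈ subdiff v x ↔ p - c ∈ subdiff u x := by
  have : ∀ y, v y - v x - inner ℝ p (y - x) = u y - u x - inner ℝ (p - c) (y - x) := by
    intro y
    rw [hv, hv, inner_sub_left, inner_sub_right c]
    ring
  simp only [subdiff, mem_ofPred_eq, this]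

end Differentials

section Lipschitz

variable {u v : EuclideanSpace ℝ (Fin n) → ℝ} {c : EuclideanSpace ℝ (Fin n)} {Mu K : ℝ}

/-- Expand (‖w + h‖ - ‖w‖)² ≥ 0. This lets the cone ‖· - x₀‖ serve as a quadratic test function away
from its vertex. -/
theorem norm_le_add_inner_add_sq {w h : EuclideanSpace ℝ (Fin n)} (hw : w ≠ 0) :
    ‖w + h‖ ≤ ‖w‖ + inner ℝ (‖w‖⁻¹ • w) h + (2 * ‖w‖)⁻¹ * ‖h‖ ^ 2 := by
  have h0 : 0 < ‖w‖ := norm_pos_iff.2 hw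
  have h1 := norm_add_sq_real w h
  rw [inner_smul_left, conj_trivial]
  have h2 : ‖w + h‖ * (2 * ‖w‖) ≤ ‖w + h‖ ^ 2 + ‖w‖ ^ 2 := by nlinarith [sq_nonneg (‖w + h‖ - ‖w‖)]
  have h3 : ‖w‖ + ‖w‖⁻¹ * inner ℝ w h + (2 * ‖w‖)⁻¹ * ‖h‖ ^ 2
      = (‖w + h‖ ^ 2 + ‖w‖ ^ 2) / (2 * ‖w‖) := by
    rw [h1]; field_simp; ring
  rw [h3, le_div_iff₀ (by positivity)]
  exact h2

/-- A bounded perturbation of a linear function whose superdifferentials are bounded is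
Lipschitz. -/
theorem lipschitz_of_superdiff_bounded (hu : Continuous u) (hMu : ∀ x, ‖u x‖ ≤ Mu)
    (hv : ∀ x, v x = u x + inner ℝ c x) (hK : ∀ x, ∀ p ∈ superdiff v x, ‖p‖ ≤ K)
    (x y : EuclideanSpace ℝ (Fin n)) : |v x - v y| ≤ (max K ‖c‖ + 1) * ‖x - y‖ := by
  have hvc : Continuous v := by
    rw [show v = fun x => u x + inner ℝ c x from funext hv]
    fun_prop
  -- A slope above K forbids contact away from the vertex of the cone; a slope of at least ‖c‖ + 1
  -- beats the linear growth of v, so a maximum exists.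
  set K' := max K ‖c‖ + 1 with hK'
  have hKK : K < K' := by linarith [le_max_left K ‖c‖]
  have hcK : ‖c‖ + 1 ≤ K' := by linarith [le_max_right K ‖c‖]
  have hK0 : 0 < K' := by linarith [norm_nonneg c]
  have hMu0 : 0 ≤ Mu := (norm_nonneg _).trans (hMu 0)
  have key : ∀ x₀ y, v y - v x₀ ≤ K' * ‖y - x₀‖ := by
    intro x₀
    obtain ⟨z, -, hz⟩ := (isCompact_closedBall x₀ (2 * Mu)).exists_isMaxOn
      ⟨x₀, Metric.mem_closedBall_self (by positivity)⟩
      (f := fun y => v y - K' * ‖y - x₀‖) (by fun_prop)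
    have hmax : ∀ y, v y - K' * ‖y - x₀‖ ≤ v z - K' * ‖z - x₀‖ := by
      intro y
      by_cases hy : y ∈ Metric.closedBall x₀ (2 * Mu)
      · exact hz hy
      have h0 : v x₀ - K' * ‖x₀ - x₀‖ ≤ v z - K' * ‖z - x₀‖ :=
        hz (Metric.mem_closedBall_self (by positivity))
      rw [sub_self, norm_zero, mul_zero, sub_zero] at h0
      rw [mem_closedBall_iff_norm, not_le] at hy
      have h1 := hv y
      have h2 := hv x₀
      have h3 : inner ℝ c y - inner ℝ c x₀ ≤ ‖c‖ * ‖y - x₀‖ := by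
        rw [← inner_sub_right]; exact real_inner_le_norm _ _
      have h4 := abs_le.1 (hMu y)
      have h5 := abs_le.1 (hMu x₀)
      nlinarith [norm_nonneg (y - x₀)]
    -- A maximum off the vertex would produce a supergradient of norm exactly K' > K.
    have hzx : z = x₀ := by
      by_contra hne
      have hw : z - x₀ ≠ 0 := sub_ne_zero.2 hne
      have hmem : K' • (‖z - x₀‖⁻¹ • (z - x₀)) ∈ superdiff v z := by
        refine mem_superdiff_of_quadratic (C := K' * (2 * ‖z - x₀‖)⁻¹) fun y => ?_
        have h1 := hmax y
        have h2 := norm_le_add_inner_add_sq (h := y - z) hw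
        rw [show z - x₀ + (y - z) = y - x₀ by abel] at h2
        rw [inner_smul_left, conj_trivial]
        nlinarith
      have := hK _ _ hmem
      rw [norm_smul, norm_smul, norm_inv, norm_norm, inv_mul_cancel₀ (norm_ne_zero_iff.2 hw),
        mul_one, Real.norm_of_nonneg hK0.le] at this
      linarith
    intro y
    have := hmax y
    rw [hzx, sub_self, norm_zero, mul_zero] at this
    linarith
  rw [abs_le]
  constructor
  · have := key x y
    rw [norm_sub_rev] at this
    linarith
  · exact key y x

end Lipschitz

section Semiconcavity

variable {u v V : EuclideanSpace ℝ (Fin n) → ℝ} {c : EuclideanSpace ℝ (Fin n)}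
  {a : EuclideanSpace ℝ (Fin n) → EuclideanSpace ℝ (Fin n) →L[ℝ] EuclideanSpace ℝ (Fin n)}
  {Mu K K' C e E l M L : ℝ}

/-- In the variables x, r = y - x, s = x + y - 2z the linear part of v contributes only ⟨c, s⟩, so
the functional is periodic in x. The penalties confine r and s, and a maximum over a compact set is
global. -/
theorem exists_max_penalized_second_difference (hu : Continuous u) (hp : ZPeriodic u)
    (hMu : ∀ x, ‖u x‖ ≤ Mu) (hv : ∀ x, v x = u x + inner ℝ c x) (hC : 1 ≤ C) (he : 1 ≤ e) :
    ∃ x y z, ∀ x' y' z',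
      v x' + v y' - 2 * v z' - C * ‖x' - y'‖ ^ 2 - e * ‖x' + y' - (2 : ℝ) • z'‖ ^ 2 ≤
      v x + v y - 2 * v z - C * ‖x - y‖ ^ 2 - e * ‖x + y - (2 : ℝ) • z‖ ^ 2 := by
  obtain ⟨S, hS, hk⟩ := exists_compact_fundamental_domain n
  have hMu0 : 0 ≤ Mu := (norm_nonneg _).trans (hMu 0)
  -- The u-terms are at most 4Mu and ⟨c, s⟩ ≤ (‖c‖² + ‖s‖²)/2, so beyond this radius the functional
  -- is negative, while it vanishes at r = s = 0.
  set R : ℝ := 8 * Mu + ‖c‖ ^ 2 + 1 with hR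
  have hR1 : 1 ≤ R := by rw [hR]; nlinarith [sq_nonneg ‖c‖]
  set Ψ : EuclideanSpace ℝ (Fin n) × EuclideanSpace ℝ (Fin n) × EuclideanSpace ℝ (Fin n) → ℝ :=
    fun t => u t.1 + u (t.1 + t.2.1) - 2 * u (t.1 + (2⁻¹ : ℝ) • (t.2.1 - t.2.2))
      + inner ℝ c t.2.2 - C * ‖t.2.1‖ ^ 2 - e * ‖t.2.2‖ ^ 2 with hΨ
  have hΨc : Continuous Ψ := by rw [hΨ]; fun_prop
  set T := S ×ˢ Metric.closedBall (0 : EuclideanSpace ℝ (Fin n)) R ×ˢ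
    Metric.closedBall (0 : EuclideanSpace ℝ (Fin n)) R with hT
  have hTc : IsCompact T := hS.prod ((isCompact_closedBall 0 R).prod (isCompact_closedBall 0 R))
  obtain ⟨k₀, hk₀⟩ := hk 0
  set x₁ := (0 : EuclideanSpace ℝ (Fin n)) + WithLp.toLp 2 (fun i => (k₀ i : ℝ))
  have hx₁ : (x₁, (0 : EuclideanSpace ℝ (Fin n)), (0 : EuclideanSpace ℝ (Fin n))) ∈ T :=
    ⟨hk₀, Metric.mem_closedBall_self (by linarith), Metric.mem_closedBall_self (by linarith)⟩
  obtain ⟨⟨x, r, s⟩, -, hmax⟩ := hTc.exists_isMaxOn ⟨_, hx₁⟩ hΨc.continuousOn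
  have h0 : 0 ≤ Ψ (x, r, s) := by
    have : Ψ (x₁, 0, 0) ≤ Ψ (x, r, s) := hmax hx₁
    refine le_trans (le_of_eq ?_) this
    simp [hΨ]; ring
  have hall : ∀ x' r' s', Ψ (x', r', s') ≤ Ψ (x, r, s) := by
    intro x' r' s'
    by_cases hrs : r' ∈ Metric.closedBall (0 : EuclideanSpace ℝ (Fin n)) R ∧
        s' ∈ Metric.closedBall (0 : EuclideanSpace ℝ (Fin n)) R
    · obtain ⟨k, hkx⟩ := hk x'
      have h1 : Ψ (x' + WithLp.toLp 2 (fun i => (k i : ℝ)), r', s') ≤ Ψ (x, r, s) :=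
        hmax (show _ ∈ T from ⟨hkx, hrs.1, hrs.2⟩)
      refine le_trans (le_of_eq ?_) h1
      simp only [hΨ]
      rw [hp, add_right_comm, hp, add_right_comm, hp]
    · refine le_trans ?_ h0
      have h1 := abs_le.1 (hMu x')
      have h2 := abs_le.1 (hMu (x' + r'))
      have h3 := abs_le.1 (hMu (x' + (2⁻¹ : ℝ) • (r' - s')))
      have h4 : inner ℝ c s' ≤ ‖c‖ * ‖s'‖ := real_inner_le_norm _ _
      have h5 : 2 * R ≤ 2 * (‖r'‖ ^ 2 + ‖s'‖ ^ 2) := by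
        rw [mem_closedBall_zero_iff, mem_closedBall_zero_iff] at hrs
        by_cases h : ‖r'‖ ≤ R
        · have h6 : R < ‖s'‖ := not_le.1 fun hs => hrs ⟨h, hs⟩
          nlinarith [sq_nonneg ‖r'‖]
        · nlinarith [sq_nonneg ‖s'‖, not_le.1 h]
      simp only [hΨ]
      nlinarith [sq_nonneg (‖c‖ - ‖s'‖), sq_nonneg ‖r'‖, sq_nonneg ‖s'‖]
  have hconv : ∀ x y z : EuclideanSpace ℝ (Fin n),
      v x + v y - 2 * v z - C * ‖x - y‖ ^ 2 - e * ‖x + y - (2 : ℝ) • z‖ ^ 2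
        = Ψ (x, y - x, x + y - (2 : ℝ) • z) := by
    intro x y z
    simp only [hΨ]
    rw [hv, hv, hv, show x + (y - x) = y by abel,
      show x + (2⁻¹ : ℝ) • (y - x - (x + y - (2 : ℝ) • z)) = z by module, inner_sub_right,
      inner_add_right, inner_smul_right, norm_sub_rev x y]
    ring
  refine ⟨x, x + r, x + (2⁻¹ : ℝ) • (r - s), fun x' y' z' => ?_⟩
  rw [hconv, hconv]
  refine (hall _ _ _).trans (le_of_eq ?_)
  congr 3
  · abel
  · module

/-- Add the inequalities at x and y and subtract twice the one at z. The terms quadratic in d keep a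
coercive contribution, the cross terms leave ⟨(a x - a y) q, d⟩, and the rest are second differences
of a and V. -/
theorem EllipticField.second_difference_estimate (ha : EllipticField a l M L)
    {x y z q d : EuclideanSpace ℝ (Fin n)} (hq : ‖q‖ ≤ K)
    (hV : |V x + V y - 2 * V z| ≤ L * (‖x - y‖ ^ 2 + ‖x + y - (2 : ℝ) • z‖))
    (hx : 1 / 2 * inner ℝ (a x (q + d)) (q + d) + V x ≤ E)
    (hy : 1 / 2 * inner ℝ (a y (q - d)) (q - d) + V y ≤ E)
    (hz : E ≤ 1 / 2 * inner ℝ (a z q) q + V z) :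
    l * ‖d‖ ^ 2 ≤ L * K * ‖x - y‖ * ‖d‖ +
      (L * K ^ 2 + L) * (‖x - y‖ ^ 2 + ‖x + y - (2 : ℝ) • z‖) := by
  have hL := ha.L_nonneg
  set D := ‖x - y‖ ^ 2 + ‖x + y - (2 : ℝ) • z‖ with hD
  have hD0 : 0 ≤ D := by positivity
  have e1 : inner ℝ (a x (q + d)) (q + d) =
      inner ℝ (a x q) q + 2 * inner ℝ (a x q) d + inner ℝ (a x d) d := by
    rw [map_add, inner_add_left, inner_add_right, inner_add_right, ha.symm x d q,
      real_inner_comm (a x q) d]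
    ring
  have e2 : inner ℝ (a y (q - d)) (q - d) =
      inner ℝ (a y q) q - 2 * inner ℝ (a y q) d + inner ℝ (a y d) d := by
    rw [map_sub, inner_sub_left, inner_sub_right, inner_sub_right, ha.symm y d q,
      real_inner_comm (a y q) d]
    ring
  have b1 : |inner ℝ (a x q) q + inner ℝ (a y q) q - 2 * inner ℝ (a z q) q| ≤ L * D * K ^ 2 := by
    have : inner ℝ (a x q) q + inner ℝ (a y q) q - 2 * inner ℝ (a z q) q
        = inner ℝ ((a x + a y - (2 : ℝ) • a z) q) q := by
      simp [inner_sub_left, inner_add_left, inner_smul_left]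
    rw [this]
    calc _ ≤ ‖(a x + a y - (2 : ℝ) • a z) q‖ * ‖q‖ := abs_real_inner_le_norm _ _
      _ ≤ (L * D * ‖q‖) * ‖q‖ := by
        gcongr
        exact ContinuousLinearMap.le_of_opNorm_le _ (ha.second_difference x y z) q
      _ = L * D * ‖q‖ ^ 2 := by ring
      _ ≤ _ := by gcongr
  have b2 : |inner ℝ (a x q) d - inner ℝ (a y q) d| ≤ L * ‖x - y‖ * K * ‖d‖ := by
    rw [← inner_sub_left]
    calc _ ≤ ‖(a x - a y) q‖ * ‖d‖ := abs_real_inner_le_norm _ _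
      _ ≤ (L * ‖x - y‖ * ‖q‖) * ‖d‖ := by
        gcongr
        exact ContinuousLinearMap.le_of_opNorm_le _ (ha.lipschitz x y) q
      _ ≤ _ := by gcongr
  have c1 := ha.coercive x d
  have c2 := ha.coercive y d
  rw [e1] at hx
  rw [e2] at hy
  have := (abs_le.1 hV).1
  have := (abs_le.1 b1).1
  have := (abs_le.1 b2).1
  have : 0 ≤ L * D * K ^ 2 := by positivity
  nlinarith

/-- A viscosity solution of the stationary equation is semiconcave: at a maximum of the penalized
second difference, the uniform convexity of the Hamiltonian beats the penalization. -/
theorem EllipticField.midpoint_semiconcave (ha : EllipticField a l M L)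
    (hV : ∀ x y z, |V x + V y - 2 * V z| ≤ L * (‖x - y‖ ^ 2 + ‖x + y - (2 : ℝ) • z‖))
    (hu : Continuous u) (hp : ZPeriodic u) (hMu : ∀ x, ‖u x‖ ≤ Mu)
    (hv : ∀ x, v x = u x + inner ℝ c x) (hK0 : 0 ≤ K)
    (hK : ∀ x, ∀ p ∈ superdiff v x, ‖p‖ ≤ K)
    (hsub : ∀ x, ∀ p ∈ superdiff v x, 1 / 2 * inner ℝ (a x p) p + V x ≤ E)
    (hsup : ∀ x, ∀ p ∈ subdiff v x, E ≤ 1 / 2 * inner ℝ (a x p) p + V x) :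
    ∃ C, 0 ≤ C ∧ ∀ x y, v x + v y - 2 * v ((2⁻¹ : ℝ) • (x + y)) ≤ C * ‖x - y‖ ^ 2 := by
  have hL := ha.L_nonneg
  have hl := ha.l_pos
  have hlip := lipschitz_of_superdiff_bounded hu hMu hv hK
  set K' := max K ‖c‖ + 1 with hK'
  have hK'0 : 0 ≤ K' := by linarith [le_max_left K ‖c‖]
  set B := L * K ^ 2 + L with hB
  have hB0 : 0 ≤ B := by positivity
  -- With d = 2Cδ the coercive term is 4lC²‖δ‖². This C makes it absorb all terms in ‖δ‖² with one
  -- ‖δ‖² to spare, leaving ‖δ‖² ≤ B‖w‖, whatever e is.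
  set C := max 1 ((2 * L * K + B + 1) / (4 * l)) with hC
  have hC1 : 1 ≤ C := le_max_left _ _
  have hCl : 2 * L * K + B + 1 ≤ C * (4 * l) := by
    rw [← div_le_iff₀ (by positivity)]; exact le_max_right _ _
  have hCC : 2 * L * K * C + B + 1 ≤ 4 * l * C ^ 2 := by
    have : 0 ≤ L * K := by positivity
    nlinarith
  refine ⟨C, by linarith, fun x₁ y₁ => ?_⟩
  suffices H : ∀ η > 0, v x₁ + v y₁ - 2 * v ((2⁻¹ : ℝ) • (x₁ + y₁)) - C * ‖x₁ - y₁‖ ^ 2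
      ≤ 2 * K' * η by
    have h1 : Tendsto (fun η => 2 * K' * η) (𝓝[>] (0 : ℝ)) (𝓝 0) := by
      have : Continuous fun η : ℝ => 2 * K' * η := by fun_prop
      simpa using (this.tendsto 0).mono_left nhdsWithin_le_nhds
    have := ge_of_tendsto h1 (eventually_mem_nhdsWithin.mono fun η hη => H η hη)
    linarith
  intro η hη
  -- Since 2e‖w‖ = ‖q‖ ≤ K, the second condition forces ‖w‖ ≤ η and the third B‖w‖ ≤ η², hence ‖δ‖ ≤
  -- η.
  obtain ⟨e, he⟩ : ∃ e : ℝ, 1 ≤ e ∧ K ≤ 2 * e * η ∧ B * K ≤ 2 * e * η ^ 2 := by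
    refine ⟨max 1 (max (K / (2 * η)) (B * K / (2 * η ^ 2))), le_max_left _ _, ?_, ?_⟩
    · have h := (div_le_iff₀ (by positivity)).1 <|
        (le_max_left (K / (2 * η)) (B * K / (2 * η ^ 2))).trans (le_max_right 1 _)
      linarith
    · have h := (div_le_iff₀ (by positivity)).1 <|
        (le_max_right (K / (2 * η)) (B * K / (2 * η ^ 2))).trans (le_max_right 1 _)
      linarith
  obtain ⟨he1, he2, he3⟩ := he
  obtain ⟨x, y, z, hmax⟩ := exists_max_penalized_second_difference hu hp hMu hv hC1 he1
  set δ := x - y with hδ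
  set w := x + y - (2 : ℝ) • z with hw
  set q := (2 * e) • w with hq
  set d := (2 * C) • δ with hd
  -- Freezing two of the three points at the maximum gives test functions: supergradients q ± d at x
  -- and y, and the subgradient q at z.
  have hpx : q + d ∈ superdiff v x := by
    refine mem_superdiff_of_quadratic (C := C + e) fun x' => ?_
    have h := hmax x' y z
    rw [show x' - y = δ + (x' - x) by rw [hδ]; abel,
      show x' + y - (2 : ℝ) • z = w + (x' - x) by rw [hw]; abel,
      norm_add_sq_real, norm_add_sq_real] at h
    rw [hq, hd, inner_add_left, inner_smul_left, inner_smul_left, conj_trivial, conj_trivial]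
    linarith
  have hpy : q - d ∈ superdiff v y := by
    refine mem_superdiff_of_quadratic (C := C + e) fun y' => ?_
    have h := hmax x y' z
    rw [show x - y' = δ - (y' - y) by rw [hδ]; abel,
      show x + y' - (2 : ℝ) • z = w + (y' - y) by rw [hw]; abel,
      norm_sub_sq_real, norm_add_sq_real] at h
    rw [hq, hd, inner_sub_left, inner_smul_left, inner_smul_left, conj_trivial, conj_trivial]
    linarith
  have hpz : q ∈ subdiff v z := by
    refine mem_subdiff_of_quadratic (C := 2 * e) fun z' => ?_
    have h := hmax x y z'
    rw [show x + y - (2 : ℝ) • z' = w - (2 : ℝ) • (z' - z) by rw [hw]; module,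
      norm_sub_sq_real w, inner_smul_right, norm_smul, mul_pow, Real.norm_of_nonneg zero_le_two] at h
    rw [hq, inner_smul_left, conj_trivial]
    linarith
  have hqK : ‖q‖ ≤ K := by
    have h1 := hK _ _ hpx
    have h2 := hK _ _ hpy
    have h3 : q = (2⁻¹ : ℝ) • (q + d) + (2⁻¹ : ℝ) • (q - d) := by module
    rw [h3]
    refine (norm_add_le _ _).trans ?_
    rw [norm_smul, norm_smul, Real.norm_of_nonneg (by norm_num)]
    linarith
  have hest := ha.second_difference_estimate hqK (hV x y z) (hsub _ _ hpx) (hsub _ _ hpy)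
    (hsup _ _ hpz)
  rw [← hδ, ← hw, hd, norm_smul, Real.norm_of_nonneg (by linarith)] at hest
  have hwq : 2 * e * ‖w‖ ≤ K := by
    rw [hq, norm_smul, Real.norm_of_nonneg (by linarith)] at hqK
    exact hqK
  have hwη : ‖w‖ ≤ η := by
    have : 2 * e * ‖w‖ ≤ 2 * e * η := hwq.trans he2
    exact le_of_mul_le_mul_left this (by linarith)
  have hδη : ‖δ‖ ≤ η := by
    have h1 : ‖δ‖ ^ 2 ≤ B * ‖w‖ := by nlinarith [sq_nonneg ‖δ‖]
    have h2 : 2 * e * (B * ‖w‖) ≤ 2 * e * η ^ 2 := by nlinarith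
    have h3 : B * ‖w‖ ≤ η ^ 2 := le_of_mul_le_mul_left h2 (by linarith)
    exact (abs_le_of_sq_le_sq' (h1.trans h3) hη.le).2
  -- At the exact midpoint the e-penalty vanishes; the maximal value is small because x, y and z are
  -- all close together.
  have h1 := hmax x₁ y₁ ((2⁻¹ : ℝ) • (x₁ + y₁))
  rw [show x₁ + y₁ - (2 : ℝ) • (2⁻¹ : ℝ) • (x₁ + y₁) = 0 by module, norm_zero] at h1
  have h2 := (abs_le.1 (hlip x z)).2
  have h3 := (abs_le.1 (hlip y z)).2
  rw [show x - z = (2⁻¹ : ℝ) • (w + δ) by rw [hw, hδ]; module, norm_smul,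
    Real.norm_of_nonneg (by norm_num)] at h2
  rw [show y - z = (2⁻¹ : ℝ) • (w - δ) by rw [hw, hδ]; module, norm_smul,
    Real.norm_of_nonneg (by norm_num)] at h3
  have h4 : ‖w + δ‖ ≤ 2 * η := (norm_add_le _ _).trans (by linarith)
  have h5 : ‖w - δ‖ ≤ 2 * η := (norm_sub_le _ _).trans (by linarith)
  have h6 : K' * (2⁻¹ * ‖w + δ‖) ≤ K' * η := by gcongr; linarith
  have h7 : K' * (2⁻¹ * ‖w - δ‖) ≤ K' * η := by gcongr; linarith
  have h8 : 0 ≤ C * ‖δ‖ ^ 2 := by positivity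
  have h9 : 0 ≤ e * ‖w‖ ^ 2 := by positivity
  linarith

end Semiconcavity

end WeakKAM

/-! ### Superdifferentials of semiconcave functions. -/

namespace WeakKAM

variable {n : ℕ} {v : EuclideanSpace ℝ (Fin n) → ℝ} {K C : ℝ}

/-- `v` is `K`-Lipschitz and semiconcave with linear modulus: superdifferentials are nonempty,
bounded by `K`, and every supergradient supports `v` globally up to `C ‖y - x‖ ^ 2`. -/
structure LipschitzSemiconcave (v : EuclideanSpace ℝ (Fin n) → ℝ) (K C : ℝ) : Prop where
  K_nonneg : 0 ≤ K
  C_nonneg : 0 ≤ C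
  lipschitz : ∀ x y, |v x - v y| ≤ K * ‖x - y‖
  nonempty : ∀ x, (superdiff v x).Nonempty
  bound : ∀ x, ∀ p ∈ superdiff v x, ‖p‖ ≤ K
  le_quadratic : ∀ x, ∀ p ∈ superdiff v x, ∀ y, v y ≤ v x + inner ℝ p (y - x) + C * ‖y - x‖ ^ 2

/-- With the constant 2C the defect g satisfies exactly g(h) ≤ 2g(h/2). Iterating, g(h) ≤ 2ᵏ
g(2⁻ᵏh), and the supergradient property makes the positive part of the right side tend to zero. -/
theorem le_quadratic_of_midpoint
    (hC : ∀ x y, v x + v y - 2 * v ((2⁻¹ : ℝ) • (x + y)) ≤ C * ‖x - y‖ ^ 2) (hC0 : 0 ≤ C)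
    {x p : EuclideanSpace ℝ (Fin n)} (hp : p ∈ superdiff v x) (y : EuclideanSpace ℝ (Fin n)) :
    v y ≤ v x + inner ℝ p (y - x) + 2 * C * ‖y - x‖ ^ 2 := by
  set g : EuclideanSpace ℝ (Fin n) → ℝ :=
    fun h => v (x + h) - v x - inner ℝ p h - 2 * C * ‖h‖ ^ 2 with hg
  have half : ∀ h, g h ≤ 2 * g ((2⁻¹ : ℝ) • h) := by
    intro h
    have := hC x (x + h)
    rw [show (2⁻¹ : ℝ) • (x + (x + h)) = x + (2⁻¹ : ℝ) • h by module,
      show x - (x + h) = -h by abel, norm_neg] at this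
    simp only [hg]
    rw [inner_smul_right, norm_smul, mul_pow, Real.norm_of_nonneg (by norm_num)]
    linarith
  have iter : ∀ (k : ℕ) h, g h ≤ 2 ^ k * g (((2 : ℝ)⁻¹ ^ k) • h) := by
    intro k
    induction k with
    | zero => intro h; simp
    | succ k ih =>
      intro h
      refine (ih h).trans ?_
      have := half (((2 : ℝ)⁻¹ ^ k) • h)
      rw [smul_smul, ← pow_succ'] at this
      rw [pow_succ, mul_assoc]
      gcongr
  have main : ∀ h, g h ≤ 0 := by
    intro h
    suffices H : ∀ ε > 0, g h ≤ ε * ‖h‖ by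
      have h1 : Tendsto (fun ε => ε * ‖h‖) (𝓝[>] (0 : ℝ)) (𝓝 0) := by
        have : Continuous fun ε : ℝ => ε * ‖h‖ := by fun_prop
        simpa using (this.tendsto 0).mono_left nhdsWithin_le_nhds
      exact ge_of_tendsto h1 (eventually_mem_nhdsWithin.mono fun η hη => H η hη)
    intro ε hε
    have ht : Tendsto (fun k : ℕ => x + ((2 : ℝ)⁻¹ ^ k) • h) atTop (𝓝 x) := by
      have h1 : Tendsto (fun k : ℕ => (2 : ℝ)⁻¹ ^ k) atTop (𝓝 0) :=
        tendsto_pow_atTop_nhds_zero_of_lt_one (by norm_num) (by norm_num)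
      simpa using (h1.smul_const h).const_add x
    obtain ⟨k, hk⟩ := (ht.eventually (hp ε hε)).exists
    rw [add_sub_cancel_left] at hk
    have h2 : g (((2 : ℝ)⁻¹ ^ k) • h) ≤ ε * ‖((2 : ℝ)⁻¹ ^ k) • h‖ := by
      simp only [hg]
      have : 0 ≤ 2 * C * ‖((2 : ℝ)⁻¹ ^ k) • h‖ ^ 2 := by positivity
      linarith
    refine (iter k h).trans ?_
    calc (2 : ℝ) ^ k * g (((2 : ℝ)⁻¹ ^ k) • h) ≤ 2 ^ k * (ε * ‖((2 : ℝ)⁻¹ ^ k) • h‖) := by gcongr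
      _ = ε * ‖h‖ := by
        rw [norm_smul, Real.norm_of_nonneg (by positivity), inv_pow]
        field_simp
  have := main (y - x)
  simp only [hg, add_sub_cancel] at this
  linarith

/-- The supporting inequality holds for all y with one constant C, so it survives limits of base
points and supergradients: the graph of D⁺v is closed. -/
theorem mem_superdiff_of_tendsto (hvc : Continuous v)
    (hq : ∀ x, ∀ p ∈ superdiff v x, ∀ y, v y ≤ v x + inner ℝ p (y - x) + C * ‖y - x‖ ^ 2)
    {ι : Type*} {F : Filter ι} [F.NeBot] {xs ps : ι → EuclideanSpace ℝ (Fin n)}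
    {x p : EuclideanSpace ℝ (Fin n)} (hx : Tendsto xs F (𝓝 x)) (hp : Tendsto ps F (𝓝 p))
    (h : ∀ᶠ i in F, ps i ∈ superdiff v (xs i)) : p ∈ superdiff v x := by
  refine mem_superdiff_of_quadratic (C := C) fun y => ?_
  have hc : Continuous fun z : EuclideanSpace ℝ (Fin n) × EuclideanSpace ℝ (Fin n) =>
      v z.1 + inner ℝ z.2 (y - z.1) + C * ‖y - z.1‖ ^ 2 := by fun_prop
  exact ge_of_tendsto ((hc.tendsto (x, p)).comp (hx.prodMk_nhds hp))
    (h.mono fun i hi => hq _ _ hi y)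

theorem continuous_of_abs_sub_le (h : ∀ x y, |v x - v y| ≤ K * ‖x - y‖) : Continuous v :=
  (LipschitzWith.of_dist_le' fun x y => by
    rw [Real.dist_eq, dist_eq_norm]; exact h x y).continuous

/-- By Rademacher, gradients exist on a dense set; they are bounded, and a cluster point is a
supergradient by closedness of the graph. -/
theorem superdiff_nonempty (hl : ∀ x y, |v x - v y| ≤ K * ‖x - y‖)
    (hK : ∀ x, ∀ p ∈ superdiff v x, ‖p‖ ≤ K)
    (hq : ∀ x, ∀ p ∈ superdiff v x, ∀ y, v y ≤ v x + inner ℝ p (y - x) + C * ‖y - x‖ ^ 2)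
    (x : EuclideanSpace ℝ (Fin n)) : (superdiff v x).Nonempty := by
  have hlip : LipschitzWith (Real.toNNReal K) v :=
    LipschitzWith.of_dist_le' fun x y => by rw [Real.dist_eq, dist_eq_norm]; exact hl x y
  have hd : Dense {y | DifferentiableAt ℝ v y} := Measure.dense_of_ae
    (hlip.ae_differentiableAt (μ := (volume : Measure (EuclideanSpace ℝ (Fin n)))))
  have hne : ∀ y, DifferentiableAt ℝ v y → (superdiff v y).Nonempty := by
    intro y hy
    refine ⟨gradient v y, fun ε hε => ?_⟩
    have h1 := (hasGradientAt_iff_isLittleO.1 hy.hasGradientAt).def hε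
    filter_upwards [h1] with z hz
    exact (le_abs_self _).trans hz
  choose! g hg using hne
  obtain ⟨ys, hys, hlim⟩ := mem_closure_iff_seq_limit.1 (hd x)
  have hmem : ∀ k, g (ys k) ∈ Metric.closedBall (0 : EuclideanSpace ℝ (Fin n)) K := fun k => by
    rw [mem_closedBall_zero_iff]; exact hK _ _ (hg _ (hys k))
  obtain ⟨p, -, φ, hφ, hp⟩ := (isCompact_closedBall _ _).tendsto_subseq hmem
  exact ⟨p, mem_superdiff_of_tendsto hlip.continuous hq (hlim.comp hφ.tendsto_atTop) hp
    (Eventually.of_forall fun k => hg _ (hys _))⟩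

namespace LipschitzSemiconcave

theorem continuous (h : LipschitzSemiconcave v K C) : Continuous v :=
  continuous_of_abs_sub_le h.lipschitz

/-- Adding the two supporting inequalities yields this one-sided Lipschitz condition, which drives
the comparisons of characteristics. -/
theorem inner_sub_le (h : LipschitzSemiconcave v K C) {x y p q : EuclideanSpace ℝ (Fin n)}
    (hp : p ∈ superdiff v x) (hq : q ∈ superdiff v y) :
    inner ℝ (p - q) (x - y) ≤ 2 * C * ‖x - y‖ ^ 2 := by
  have h1 := h.le_quadratic x p hp y
  have h2 := h.le_quadratic y q hq x
  rw [inner_sub_left]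
  rw [← neg_sub x y, inner_neg_right, norm_neg] at h1
  linarith

theorem isClosed_superdiff (h : LipschitzSemiconcave v K C) (x : EuclideanSpace ℝ (Fin n)) :
    IsClosed (superdiff v x) := by
  refine IsSeqClosed.isClosed fun ps p hps hp => ?_
  exact mem_superdiff_of_tendsto h.continuous h.le_quadratic tendsto_const_nhds hp
    (Eventually.of_forall hps)

theorem isCompact_superdiff (h : LipschitzSemiconcave v K C) (x : EuclideanSpace ℝ (Fin n)) :
    IsCompact (superdiff v x) :=
  (isCompact_closedBall 0 K).of_isClosed_subset (h.isClosed_superdiff x) fun p hp => by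
    rw [mem_closedBall_zero_iff]; exact h.bound x p hp

theorem tendsto_of_superdiff_eq_singleton (h : LipschitzSemiconcave v K C)
    {x p : EuclideanSpace ℝ (Fin n)} (hx : superdiff v x = {p}) {ε : ℝ} (hε : 0 < ε) :
    ∀ᶠ y in 𝓝 x, ∀ q ∈ superdiff v y, ‖q - p‖ < ε := by
  by_contra hcon
  rw [not_eventually] at hcon
  obtain ⟨ys, hlim, hys⟩ := exists_seq_forall_of_frequently hcon
  push Not at hys
  choose q hq hqε using hys
  have hmem : ∀ k, q k ∈ Metric.closedBall (0 : EuclideanSpace ℝ (Fin n)) K := fun k => by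
    rw [mem_closedBall_zero_iff]; exact h.bound _ _ (hq k)
  obtain ⟨p', -, φ, hφ, hp'⟩ := (isCompact_closedBall _ _).tendsto_subseq hmem
  have h1 : p' ∈ superdiff v x := mem_superdiff_of_tendsto h.continuous h.le_quadratic
    (hlim.comp hφ.tendsto_atTop) hp' (Eventually.of_forall fun k => hq _)
  rw [hx, mem_singleton_iff] at h1
  subst h1
  have h2 : Tendsto (fun k => ‖(q ∘ φ) k - p'‖) atTop (𝓝 0) := by
    simpa using (hp'.sub_const p').norm
  exact absurd (ge_of_tendsto h2 (Eventually.of_forall fun k => hqε (φ k))) (not_le.2 hε)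

/-- Evaluating at x the supporting inequality based at y bounds v(y) - v(x) from below by ⟨q, y - x⟩
up to a quadratic error, and q → p by upper semicontinuity. -/
theorem mem_subdiff_of_superdiff_eq_singleton (h : LipschitzSemiconcave v K C)
    {x p : EuclideanSpace ℝ (Fin n)} (hx : superdiff v x = {p}) : p ∈ subdiff v x := by
  intro ε hε
  filter_upwards [h.tendsto_of_superdiff_eq_singleton hx (half_pos hε),
    eventually_sq_le (half_pos hε) C x] with y hy hy'
  obtain ⟨q, hq⟩ := h.nonempty y
  have h1 := h.le_quadratic y q hq x
  have h2 := (hy q hq).le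
  have h3 : inner ℝ (p - q) (y - x) ≤ ‖q - p‖ * ‖y - x‖ := by
    rw [norm_sub_rev q p]; exact real_inner_le_norm _ _
  have h4 : ‖q - p‖ * ‖y - x‖ ≤ ε / 2 * ‖y - x‖ := by gcongr
  rw [← neg_sub y x, inner_neg_right, norm_neg] at h1
  rw [inner_sub_left] at h3
  linarith

end LipschitzSemiconcave

theorem convex_superdiff (x : EuclideanSpace ℝ (Fin n)) : Convex ℝ (superdiff v x) := by
  intro p hp q hq s t hs ht hst ε hε
  filter_upwards [hp ε hε, hq ε hε] with y h1 h2
  rw [inner_add_left, inner_smul_left, inner_smul_left, conj_trivial, conj_trivial]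
  have e1 : s * (v y - v x - inner ℝ p (y - x)) + t * (v y - v x - inner ℝ q (y - x)) ≤
      s * (ε * ‖y - x‖) + t * (ε * ‖y - x‖) := by gcongr
  have e2 : s = 1 - t := by linarith
  subst e2
  linarith

theorem EllipticField.lipschitzSemiconcave
    {u V : EuclideanSpace ℝ (Fin n) → ℝ} {c : EuclideanSpace ℝ (Fin n)}
    {a : EuclideanSpace ℝ (Fin n) → EuclideanSpace ℝ (Fin n) →L[ℝ] EuclideanSpace ℝ (Fin n)}
    {MV E l M L : ℝ} (ha : EllipticField a l M L)
    (hV : ∀ x y z, |V x + V y - 2 * V z| ≤ L * (‖x - y‖ ^ 2 + ‖x + y - (2 : ℝ) • z‖))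
    (hMV : ∀ x, ‖V x‖ ≤ MV)
    (hu : Continuous u) (hp : ZPeriodic u) (hv : ∀ x, v x = u x + inner ℝ c x)
    (hsub : ∀ x, ∀ p ∈ superdiff v x, 1 / 2 * inner ℝ (a x p) p + V x ≤ E)
    (hsup : ∀ x, ∀ p ∈ subdiff v x, E ≤ 1 / 2 * inner ℝ (a x p) p + V x) :
    ∃ K C, LipschitzSemiconcave v K C := by
  obtain ⟨Mu, -, hMu⟩ := hp.exists_bound hu
  have hl := ha.l_pos
  have hK : ∀ x, ∀ p ∈ superdiff v x, ‖p‖ ≤ 2 * (|E| + MV) / l + 1 := by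
    intro x p hp
    have h1 := hsub x p hp
    have h2 := ha.coercive x p
    have h3 := (abs_le.1 (hMV x)).1
    have h4 : ‖p‖ ^ 2 ≤ 2 * (|E| + MV) / l := by
      rw [le_div_iff₀ hl]
      linarith [le_abs_self E]
    -- Uses t ≤ t² + 1 in place of a square root.
    nlinarith [sq_nonneg (‖p‖ - 1)]
  have hMV0 : 0 ≤ MV := (norm_nonneg _).trans (hMV 0)
  obtain ⟨C, hC0, hC⟩ := ha.midpoint_semiconcave hV hu hp hMu hv (by positivity) hK hsub hsup
  have hlip := lipschitz_of_superdiff_bounded hu hMu hv hK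
  have hq := fun x p hp => le_quadratic_of_midpoint hC hC0 (x := x) (p := p) hp
  have hK' : ∀ x, ∀ p ∈ superdiff v x, ‖p‖ ≤ max (2 * (|E| + MV) / l + 1) ‖c‖ + 1 :=
    fun x p hp => (hK x p hp).trans (by linarith [le_max_left (2 * (|E| + MV) / l + 1) ‖c‖])
  exact ⟨_, 2 * C, by positivity, by positivity, hlip, superdiff_nonempty hlip hK' hq, hK', hq⟩

end WeakKAM

/-! ### Inverse metric and forward characteristics as limits of Euler polygons. -/

namespace WeakKAM

variable {n : ℕ} {v : EuclideanSpace ℝ (Fin n) → ℝ} {K C l M L : ℝ}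
  {a b : EuclideanSpace ℝ (Fin n) → EuclideanSpace ℝ (Fin n) →L[ℝ] EuclideanSpace ℝ (Fin n)}

/-- An elliptic field together with the field of inverse operators. -/
structure EllipticPair
    (a b : EuclideanSpace ℝ (Fin n) → EuclideanSpace ℝ (Fin n) →L[ℝ] EuclideanSpace ℝ (Fin n))
    (l M L : ℝ) : Prop extends EllipticField a l M L where
  apply_inv : ∀ x p, a x (b x p) = p
  inv_apply : ∀ x p, b x (a x p) = p

namespace EllipticPair

theorem inv_symm (h : EllipticPair a b l M L) (x p q : EuclideanSpace ℝ (Fin n)) :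
    inner ℝ (b x p) q = inner ℝ p (b x q) := by
  conv_lhs => rw [← h.apply_inv x q]
  rw [← h.symm, h.apply_inv]

theorem norm_inv_apply_le (h : EllipticPair a b l M L) (x p : EuclideanSpace ℝ (Fin n)) :
    ‖b x p‖ ≤ l⁻¹ * ‖p‖ := by
  have hl := h.l_pos
  have h1 := h.coercive x (b x p)
  rw [h.apply_inv] at h1
  have h2 := real_inner_le_norm p (b x p)
  rw [inv_mul_eq_div, le_div_iff₀ hl]
  by_contra hcon
  rw [not_le] at hcon
  have h3 : 0 < ‖b x p‖ := by
    by_contra h0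
    have : ‖b x p‖ = 0 := le_antisymm (not_lt.1 h0) (norm_nonneg _)
    rw [this, zero_mul] at hcon
    exact absurd hcon (not_lt.2 (norm_nonneg _))
  nlinarith

theorem norm_inv_sub_inv_le (h : EllipticPair a b l M L) (x y : EuclideanSpace ℝ (Fin n)) :
    ‖b x - b y‖ ≤ l⁻¹ * L * l⁻¹ * ‖x - y‖ := by
  have hl := h.l_pos
  have hL := h.L_nonneg
  refine ContinuousLinearMap.opNorm_le_bound _ (by positivity) fun p => ?_
  have e : (b x - b y) p = b x ((a y - a x) (b y p)) := by
    simp [h.apply_inv, h.inv_apply]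
  rw [e]
  refine (h.norm_inv_apply_le x _).trans ?_
  have h1 := ContinuousLinearMap.le_of_opNorm_le _ (h.lipschitz y x) (b y p)
  have h2 := h.norm_inv_apply_le y p
  calc l⁻¹ * ‖(a y - a x) (b y p)‖ ≤ l⁻¹ * (L * ‖y - x‖ * (l⁻¹ * ‖p‖)) := by
        gcongr; exact h1.trans (by gcongr)
    _ = _ := by rw [norm_sub_rev]; ring

theorem inv_coercive (h : EllipticPair a b l M L) (x p : EuclideanSpace ℝ (Fin n)) :
    l * ‖b x p‖ ^ 2 ≤ inner ℝ (b x p) p := by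
  have := h.coercive x (b x p)
  rwa [h.apply_inv, real_inner_comm] at this

/-- The cost of freezing the metric: b y undoes a x only up to an error of order ‖x - y‖. -/
theorem abs_inner_inv_apply_sub_le (h : EllipticPair a b l M L)
    {x y p w : EuclideanSpace ℝ (Fin n)} (hp : ‖p‖ ≤ K) :
    |inner ℝ (b y (a x p)) w - inner ℝ p w| ≤ l⁻¹ * L * K * ‖x - y‖ * ‖w‖ := by
  have hl := h.l_pos
  have hL := h.L_nonneg
  have e : inner ℝ (b y (a x p)) w - inner ℝ p w = inner ℝ (b y ((a x - a y) p)) w := by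
    simp [h.inv_apply, inner_sub_left]
  rw [e]
  refine (abs_real_inner_le_norm _ _).trans ?_
  gcongr
  calc ‖b y ((a x - a y) p)‖ ≤ l⁻¹ * ‖(a x - a y) p‖ := h.norm_inv_apply_le _ _
    _ ≤ l⁻¹ * (L * ‖x - y‖ * ‖p‖) := by
      gcongr; exact ContinuousLinearMap.le_of_opNorm_le _ (h.lipschitz x y) p
    _ ≤ l⁻¹ * (L * ‖x - y‖ * K) := by gcongr
    _ = _ := by ring

end EllipticPair

section Euler

variable {p : EuclideanSpace ℝ (Fin n) → EuclideanSpace ℝ (Fin n)} {τ : ℝ}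

theorem norm_euler_sub_le {f : EuclideanSpace ℝ (Fin n) → EuclideanSpace ℝ (Fin n)} {R : ℝ}
    (hf : ∀ x, ‖f x‖ ≤ R) (hτ : 0 ≤ τ) (x : EuclideanSpace ℝ (Fin n)) {i j : ℕ} (hij : i ≤ j) :
    ‖(fun x => x + τ • f x)^[j] x - (fun x => x + τ • f x)^[i] x‖ ≤ R * (τ * j - τ * i) := by
  induction j, hij using Nat.le_induction with
  | base => simp
  | succ j hij ih =>
    rw [Function.iterate_succ_apply', add_sub_right_comm]
    refine (norm_add_le _ _).trans ?_
    rw [norm_smul, Real.norm_of_nonneg hτ]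
    have := mul_le_mul_of_nonneg_left (hf ((fun x => x + τ • f x)^[j] x)) hτ
    push_cast
    linarith

/-- The supporting inequality at the current node x is tested at z + w and rewritten around a fixed
z. In this form it is linear in the velocity a x q, so it can be summed over steps and passed to the
limit without convergence of the chosen supergradients. -/
theorem EllipticPair.euler_step (h : EllipticPair a b l M L) (hv : LipschitzSemiconcave v K C)
    {x z w q : EuclideanSpace ℝ (Fin n)} (hq : q ∈ superdiff v x) {r : ℝ} (hr : ‖x - z‖ ≤ r) :
    v (z + w) - v z - C * ‖w‖ ^ 2
      - (2 * K + 2 * C * ‖w‖ + C * r + l⁻¹ * L * K * ‖w‖) * r ≤ inner ℝ (b z (a x q)) w := by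
  have hK := hv.K_nonneg
  have hC := hv.C_nonneg
  have hL := h.L_nonneg
  have hl := h.l_pos
  have h1 := (abs_le.1 (h.abs_inner_inv_apply_sub_le (x := x) (y := z) (w := w)
    (hv.bound _ _ hq))).1
  have h2 := hv.le_quadratic x q hq (z + w)
  have h3 : inner ℝ q (z + w - x) ≤ inner ℝ q w + K * r := by
    rw [show z + w - x = w + (z - x) by abel, inner_add_right]
    have := real_inner_le_norm q (z - x)
    rw [norm_sub_rev] at this
    have : ‖q‖ * ‖x - z‖ ≤ K * r := by gcongr; exact hv.bound _ _ hq
    linarith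
  have h4 := (abs_le.1 (hv.lipschitz x z)).2
  have h5 : K * ‖x - z‖ ≤ K * r := by gcongr
  have h6 : ‖z + w - x‖ ≤ ‖w‖ + r := by
    rw [show z + w - x = w + (z - x) by abel]
    refine (norm_add_le _ _).trans ?_
    rw [norm_sub_rev z x]
    gcongr
  have h7 : C * ‖z + w - x‖ ^ 2 ≤ C * (‖w‖ + r) ^ 2 := by gcongr
  have h8 : l⁻¹ * L * K * ‖x - z‖ * ‖w‖ ≤ l⁻¹ * L * K * r * ‖w‖ := by gcongr
  nlinarith

theorem EllipticPair.euler_sum (h : EllipticPair a b l M L) (hv : LipschitzSemiconcave v K C)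
    (hp : ∀ x, p x ∈ superdiff v x) (hτ : 0 ≤ τ) (x : EuclideanSpace ℝ (Fin n))
    {z w : EuclideanSpace ℝ (Fin n)} {r : ℝ} {i j : ℕ} (hij : i ≤ j)
    (hr : ∀ k, i ≤ k → k ≤ j → ‖(fun x => x + τ • a x (p x))^[k] x - z‖ ≤ r) :
    (τ * j - τ * i) * (v (z + w) - v z - C * ‖w‖ ^ 2
      - (2 * K + 2 * C * ‖w‖ + C * r + l⁻¹ * L * K * ‖w‖) * r) ≤
    inner ℝ (b z ((fun x => x + τ • a x (p x))^[j] x - (fun x => x + τ • a x (p x))^[i] x)) w := by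
  induction j, hij using Nat.le_induction with
  | base => simp
  | succ j hij ih =>
    have h1 := ih fun k hk hkj => hr k hk (hkj.trans (Nat.le_succ j))
    have h2 := mul_le_mul_of_nonneg_left
      (h.euler_step hv (w := w) (hp ((fun x => x + τ • a x (p x))^[j] x))
        (hr j hij (Nat.le_succ j))) hτ
    rw [Function.iterate_succ_apply', add_sub_right_comm, map_add, inner_add_left, map_smul,
      inner_smul_left, conj_trivial]
    push_cast
    linarith

theorem tendsto_floor_step (t : ℝ) :
    Tendsto (fun N : ℕ => ((N : ℝ) + 1)⁻¹ * (⌊t * ((N : ℝ) + 1)⌋₊ : ℝ)) atTop (𝓝 (max t 0)) := by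
  have hN : Tendsto (fun N : ℕ => (N : ℝ) + 1) atTop atTop :=
    tendsto_atTop_add_const_right _ _ tendsto_natCast_atTop_atTop
  rcases le_total 0 t with ht | ht
  · rw [max_eq_left ht]
    refine ((tendsto_nat_floor_mul_div_atTop ht).comp hN).congr fun N => ?_
    simp [div_eq_inv_mul]
  · rw [max_eq_right ht]
    refine tendsto_const_nhds.congr fun N => ?_
    rw [Nat.floor_of_nonpos (mul_nonpos_of_nonpos_of_nonneg ht (by positivity))]
    simp

/-- `ξ` is Lipschitz and every limit `w` of its right difference quotients at `t ≥ 0` satisfies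
`w = a(ξ(t)) p` for some `p ∈ D⁺v(ξ(t))`. -/
structure IsForwardCharacteristic
    (b : EuclideanSpace ℝ (Fin n) → EuclideanSpace ℝ (Fin n) →L[ℝ] EuclideanSpace ℝ (Fin n))
    (v : EuclideanSpace ℝ (Fin n) → ℝ) (R : ℝ) (ξ : ℝ → EuclideanSpace ℝ (Fin n)) : Prop where
  lipschitz : ∀ s t, ‖ξ s - ξ t‖ ≤ R * |s - t|
  slope_mem : ∀ t, 0 ≤ t → ∀ F : Filter ℝ, F.NeBot → F ≤ 𝓝[>] t → ∀ w,
    Tendsto (slope ξ t) F (𝓝 w) → b (ξ t) w ∈ superdiff v (ξ t)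

/-- Existence of forward characteristics: a limit of Euler polygons. -/
theorem EllipticPair.exists_forwardCharacteristic (h : EllipticPair a b l M L)
    (hv : LipschitzSemiconcave v K C) (x₀ : EuclideanSpace ℝ (Fin n)) :
    ∃ ξ, IsForwardCharacteristic b v (M * K) ξ ∧ ξ 0 = x₀ := by
  choose p hp using hv.nonempty
  have hK := hv.K_nonneg
  have hM := h.M_nonneg
  set R := M * K with hR
  have hR0 : 0 ≤ R := by positivity
  have hf : ∀ x, ‖a x (p x)‖ ≤ R := fun x => by
    exact (ContinuousLinearMap.le_of_opNorm_le _ (h.bound x) _).trans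
      (mul_le_mul_of_nonneg_left (hv.bound _ _ (hp x)) hM)
  set X : ℕ → ℕ → EuclideanSpace ℝ (Fin n) :=
    fun N k => (fun x => x + ((N : ℝ) + 1)⁻¹ • a x (p x))^[k] x₀ with hX
  -- Number of steps of length 1/(N+1) taken by time t; it is zero for t ≤ 0, so the limit arc rests
  -- at x₀ for negative times.
  set j : ℕ → ℝ → ℕ := fun N t => ⌊t * ((N : ℝ) + 1)⌋₊ with hj
  set T : ℕ → ℝ → ℝ := fun N t => ((N : ℝ) + 1)⁻¹ * (j N t : ℝ) with hT
  have hXsub : ∀ N i k, i ≤ k → ‖X N k - X N i‖ ≤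
      R * (((N : ℝ) + 1)⁻¹ * k - ((N : ℝ) + 1)⁻¹ * i) := fun N i k hik =>
    norm_euler_sub_le hf (by positivity) x₀ hik
  have hjm : ∀ N s t, s ≤ t → j N s ≤ j N t := fun N s t hst => Nat.floor_mono (by gcongr)
  -- An ultrafilter gives limits at all times simultaneously, replacing Arzelà–Ascoli and a diagonal
  -- subsequence.
  set 𝒰 : Filter ℕ := (hyperfilter ℕ : Filter ℕ) with h𝒰
  have hT' : ∀ t, Tendsto (fun N => T N t) 𝒰 (𝓝 (max t 0)) := fun t =>
    (tendsto_floor_step t).mono_left Nat.hyperfilter_le_atTop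
  have hlim : ∀ t, ∃ y, Tendsto (fun N => X N (j N t)) 𝒰 (𝓝 y) := by
    intro t
    have hb : ∀ N, X N (j N t) ∈ Metric.closedBall x₀ (R * max t 0) := by
      intro N
      rw [mem_closedBall_iff_norm]
      refine (hXsub N 0 (j N t) (Nat.zero_le _)).trans ?_
      gcongr
      rw [Nat.cast_zero, mul_zero, sub_zero, inv_mul_le_iff₀ (by positivity)]
      rcases le_total 0 t with ht | ht
      · rw [max_eq_left ht, mul_comm]
        exact Nat.floor_le (by positivity)
      · rw [max_eq_right ht, mul_zero]
        simp only [hj]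
        rw [Nat.floor_of_nonpos (mul_nonpos_of_nonpos_of_nonneg ht (by positivity))]
        simp
    obtain ⟨y, -, hy⟩ := (isCompact_closedBall x₀ (R * max t 0)).ultrafilter_le_nhds
      ((hyperfilter ℕ).map fun N => X N (j N t)) (by
        rw [le_principal_iff]; exact mem_map.2 (Eventually.of_forall hb))
    exact ⟨y, hy⟩
  choose ξ hξ using hlim
  have hlip' : ∀ s t, s ≤ t → ‖ξ t - ξ s‖ ≤ R * (max t 0 - max s 0) := fun s t hst =>
    le_of_tendsto_of_tendsto ((hξ t).sub (hξ s)).norm (((hT' t).sub (hT' s)).const_mul R)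
      (Eventually.of_forall fun N => hXsub N _ _ (hjm N s t hst))
  have hlip : ∀ s t, s ≤ t → ‖ξ t - ξ s‖ ≤ R * |t - s| := fun s t hst =>
    (hlip' s t hst).trans (by
      gcongr
      exact (le_abs_self _).trans (abs_max_sub_max_le_abs t s 0))
  refine ⟨ξ, ⟨fun s t => ?_, fun t ht F hF hFt w hw => ?_⟩, ?_⟩
  · rcases le_total s t with hst | hst
    · rw [norm_sub_rev, abs_sub_comm]; exact hlip s t hst
    · exact hlip t s hst
  · refine mem_superdiff_of_quadratic (C := C) fun y => ?_
    set z := ξ t with hz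
    set d := y - z with hd
    have hzd : z + d = y := by rw [hd]; abel
    have key : ∀ s, t < s → v y - v z - C * ‖d‖ ^ 2 - (2 * K + 2 * C * ‖d‖ + C * (R * (s - t))
        + l⁻¹ * L * K * ‖d‖) * (R * (s - t)) ≤ inner ℝ (b z (slope ξ t s)) d := by
      intro s hts
      -- All nodes between times t and s lie within r N of z, and r N tends to R(s - t).
      set r : ℕ → ℝ := fun N => R * (T N s - T N t) + ‖X N (j N t) - z‖ with hr
      have hrl : Tendsto r 𝒰 (𝓝 (R * (s - t))) := by
        have h1 := (((hT' s).sub (hT' t)).const_mul R).add ((hξ t).sub_const z).norm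
        rwa [max_eq_left ht, max_eq_left (ht.trans hts.le), ← hz, sub_self, norm_zero,
          add_zero] at h1
      have hTl : Tendsto (fun N => T N s - T N t) 𝒰 (𝓝 (s - t)) := by
        have h1 := (hT' s).sub (hT' t)
        rwa [max_eq_left ht, max_eq_left (ht.trans hts.le)] at h1
      have hstep : ∀ N, (T N s - T N t) * (v y - v z - C * ‖d‖ ^ 2 - (2 * K + 2 * C * ‖d‖
          + C * r N + l⁻¹ * L * K * ‖d‖) * r N) ≤
          inner ℝ (b z (X N (j N s) - X N (j N t))) d := by
        intro N
        rw [← hzd]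
        refine h.euler_sum hv hp (by positivity) x₀ (hjm N t s hts.le) fun k hk hk' => ?_
        have h1 := hXsub N _ _ hk
        have h2 : R * (((N : ℝ) + 1)⁻¹ * k - T N t) ≤ R * (T N s - T N t) := by
          simp only [hT]; gcongr
        calc ‖X N k - z‖ ≤ ‖X N k - X N (j N t)‖ + ‖X N (j N t) - z‖ :=
              norm_sub_le_norm_sub_add_norm_sub _ _ _
          _ ≤ r N := by simp only [hr]; gcongr; exact h1.trans h2
      have hG : Continuous fun r : ℝ => v y - v z - C * ‖d‖ ^ 2 - (2 * K + 2 * C * ‖d‖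
          + C * r + l⁻¹ * L * K * ‖d‖) * r := by fun_prop
      have hI : Continuous fun x => inner ℝ (b z x) d := by fun_prop
      have h3 := le_of_tendsto_of_tendsto (hTl.mul ((hG.tendsto _).comp hrl))
        ((hI.tendsto _).comp ((hξ s).sub (hξ t))) (Eventually.of_forall hstep)
      rw [slope_def_module, map_smul, inner_smul_left, conj_trivial,
        le_inv_mul_iff₀ (sub_pos.2 hts)]
      exact h3
    have hGc : Continuous fun s : ℝ => v y - v z - C * ‖d‖ ^ 2 - (2 * K + 2 * C * ‖d‖
        + C * (R * (s - t)) + l⁻¹ * L * K * ‖d‖) * (R * (s - t)) := by fun_prop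
    have hG : Tendsto (fun s : ℝ => v y - v z - C * ‖d‖ ^ 2 - (2 * K + 2 * C * ‖d‖
        + C * (R * (s - t)) + l⁻¹ * L * K * ‖d‖) * (R * (s - t))) F
        (𝓝 (v y - v z - C * ‖d‖ ^ 2)) := by
      have := (hGc.tendsto t).mono_left (hFt.trans nhdsWithin_le_nhds)
      simpa using this
    have hI : Continuous fun x => inner ℝ (b z x) d := by fun_prop
    have := le_of_tendsto_of_tendsto hG ((hI.tendsto _).comp hw)
      (mem_of_superset (hFt self_mem_nhdsWithin) fun s hs => key s hs)
    linarith
  · refine tendsto_nhds_unique (hξ 0) (tendsto_const_nhds.congr fun N => ?_)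
    simp [hX, hj]

end Euler

end WeakKAM

/-! ### Initial velocity and energy of forward characteristics. -/

namespace WeakKAM

variable {n : ℕ} {v : EuclideanSpace ℝ (Fin n) → ℝ} {K C l M L R : ℝ}
  {a b : EuclideanSpace ℝ (Fin n) → EuclideanSpace ℝ (Fin n) →L[ℝ] EuclideanSpace ℝ (Fin n)}
  {ξ : ℝ → EuclideanSpace ℝ (Fin n)} {x₀ p₀ : EuclideanSpace ℝ (Fin n)}

/-- Along an arc, a supergradient computes the derivative of `v`. -/
theorem LipschitzSemiconcave.hasDerivAt_comp_eq (hv : LipschitzSemiconcave v K C) {s d : ℝ}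
    {w p : EuclideanSpace ℝ (Fin n)} (hξ : HasDerivAt ξ w s)
    (hd : HasDerivAt (fun t => v (ξ t)) d s) (hp : p ∈ superdiff v (ξ s)) : d = inner ℝ p w := by
  have h1 : HasDerivAt (fun t => inner ℝ p (ξ t)) (inner ℝ p w) s := by
    simpa using (hasDerivAt_const s p).inner ℝ hξ
  have h2 : HasDerivAt (fun t => ‖ξ t - ξ s‖ ^ 2) 0 s := by
    simpa using (hξ.sub_const (ξ s)).norm_sq
  have h3 := (hd.sub h1).sub (h2.const_mul C)
  -- The supporting inequality says this difference is maximal at s, so its derivative vanishes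
  -- there.
  have hmax : IsLocalMax ((fun t => v (ξ t)) - (fun t => inner ℝ p (ξ t))
      - fun t => C * ‖ξ t - ξ s‖ ^ 2) s := by
    refine Eventually.of_forall fun t => ?_
    have := hv.le_quadratic _ _ hp (ξ t)
    simp only [Pi.sub_apply, sub_self, norm_zero]
    rw [inner_sub_right] at this
    linarith
  have := hmax.hasDerivAt_eq_zero h3
  linarith

namespace IsForwardCharacteristic

theorem nonneg (h : IsForwardCharacteristic b v R ξ) : 0 ≤ R := by
  have := (norm_nonneg _).trans (h.lipschitz 1 0)
  simpa using this

theorem lipschitzWith (h : IsForwardCharacteristic b v R ξ) : LipschitzWith (Real.toNNReal R) ξ :=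
  LipschitzWith.of_dist_le' fun s t => by
    rw [dist_eq_norm, Real.dist_eq]; exact h.lipschitz s t

theorem inv_mem_superdiff (h : IsForwardCharacteristic b v R ξ) {s : ℝ} (hs : 0 ≤ s)
    {w : EuclideanSpace ℝ (Fin n)} (hw : HasDerivAt ξ w s) : b (ξ s) w ∈ superdiff v (ξ s) :=
  h.slope_mem s hs _ inferInstance le_rfl w
    ((hasDerivAt_iff_tendsto_slope.1 hw).mono_left (nhdsWithin_mono _ fun _ ht => ne_of_gt ht))

theorem ae_hasDerivAt (h : IsForwardCharacteristic b v R ξ) :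
    ∀ᵐ s, ∃ w, HasDerivAt ξ w s :=
  h.lipschitzWith.ae_differentiableAt_real.mono fun _ hs => ⟨_, hs.hasDerivAt⟩

theorem norm_slope_le (h : IsForwardCharacteristic b v R ξ) {s t : ℝ} (hst : s ≠ t) :
    ‖slope ξ t s‖ ≤ R := by
  have h0 : 0 < |s - t| := abs_pos.2 (sub_ne_zero.2 hst)
  rw [slope_def_module, norm_smul, norm_inv, Real.norm_eq_abs, inv_mul_le_iff₀ h0, mul_comm]
  exact h.lipschitz s t

/-- Almost everywhere ξ' = a(ξ)p and (v ∘ ξ)' = ⟨p, a(ξ)p⟩, which is at least 2⟨q, ξ'⟩ - ⟨a(ξ)q, q⟩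
because ⟨a(ξ)(p - q), p - q⟩ ≥ 0. Replacing a(ξ) by a(x₀) costs the s² term. -/
theorem lower_bound (h : IsForwardCharacteristic b v R ξ) (ha : EllipticPair a b l M L)
    (hv : LipschitzSemiconcave v K C) (h0 : ξ 0 = x₀) {q : EuclideanSpace ℝ (Fin n)}
    (hq : ‖q‖ ≤ K) {s : ℝ} (hs : 0 ≤ s) :
    2 * inner ℝ q (ξ s - x₀) - s * inner ℝ (a x₀ q) q - L * R * K ^ 2 * s ^ 2 ≤
      v (ξ s) - v x₀ := by
  have hR := h.nonneg
  have hL := ha.L_nonneg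
  have hvlip : LipschitzWith (Real.toNNReal K) v := LipschitzWith.of_dist_le' fun x y => by
    rw [Real.dist_eq, dist_eq_norm]; exact hv.lipschitz x y
  have hvξ := hvlip.comp h.lipschitzWith
  obtain ⟨K₁, hK₁⟩ := exists_lipschitzOnWith_comp
    (g := fun z : EuclideanSpace ℝ (Fin n) × ℝ × ℝ => 2 * inner ℝ q z.1
      - z.2.1 * inner ℝ (a x₀ q) q - L * R * K ^ 2 * s * z.2.1 - z.2.2)
    ((((contDiff_const.inner ℝ contDiff_fst).const_smul (2 : ℝ)).sub (by fun_prop)).sub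
      (by fun_prop) |>.sub (by fun_prop)) (f := fun σ => (ξ σ, σ, v (ξ σ))) (a := 0) (b := s)
    (h.lipschitzWith.prodMk (LipschitzWith.id.prodMk hvξ)).lipschitzOnWith
  have hmono := le_of_ae_hasDerivAt_nonpos hs hK₁ (by
    filter_upwards [h.ae_hasDerivAt, hvξ.ae_differentiableAt_real] with σ h1 h2 hσ
    obtain ⟨w, hw⟩ := h1
    set p := b (ξ σ) w with hp
    have hpm : p ∈ superdiff v (ξ σ) := h.inv_mem_superdiff hσ.1.le hw
    have hwp : w = a (ξ σ) p := (ha.apply_inv _ _).symm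
    have hd := h2.hasDerivAt
    rw [hv.hasDerivAt_comp_eq hw hd hpm] at hd
    have hi : HasDerivAt (fun t => inner ℝ q (ξ t)) (inner ℝ q w) σ := by
      simpa using (hasDerivAt_const σ q).inner ℝ hw
    refine ⟨_, ?_, (((hi.const_mul 2).sub ((hasDerivAt_id σ).mul_const (inner ℝ (a x₀ q) q))).sub
      ((hasDerivAt_id σ).const_mul (L * R * K ^ 2 * s))).sub hd⟩
    have e1 := ha.coercive (ξ σ) (p - q)
    have e2 : inner ℝ (a (ξ σ) (p - q)) (p - q) = inner ℝ p w - 2 * inner ℝ q w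
        + inner ℝ (a (ξ σ) q) q := by
      rw [hwp, map_sub, inner_sub_left, inner_sub_right, inner_sub_right,
        real_inner_comm p (a (ξ σ) p), real_inner_comm q (a (ξ σ) p), ha.symm (ξ σ) q p]
      ring
    have e3 : inner ℝ (a (ξ σ) q) q - inner ℝ (a x₀ q) q ≤ L * R * K ^ 2 * s := by
      rw [← inner_sub_left]
      have h3 : ‖ξ σ - x₀‖ ≤ R * s := by
        rw [← h0]
        refine (h.lipschitz σ 0).trans ?_
        rw [sub_zero, abs_of_pos hσ.1]
        have := hσ.2.le
        gcongr
      calc inner ℝ (a (ξ σ) q - a x₀ q) q ≤ ‖(a (ξ σ) - a x₀) q‖ * ‖q‖ := real_inner_le_norm _ _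
        _ ≤ (L * (R * s) * ‖q‖) * ‖q‖ := by
          gcongr
          refine (ContinuousLinearMap.le_of_opNorm_le _ (ha.lipschitz _ _) q).trans ?_
          gcongr
        _ = L * R * ‖q‖ ^ 2 * s := by ring
        _ ≤ _ := by gcongr
    have : 0 ≤ l * ‖p - q‖ ^ 2 := by have := ha.l_pos; positivity
    linarith)
  rw [h0] at hmono
  rw [inner_sub_right]
  simp only [zero_mul, mul_zero, sub_zero] at hmono
  linarith

/-- The right derivative of a forward characteristic at its starting point is given by the
supergradient of least energy. -/
theorem tendsto_slope_zero (h : IsForwardCharacteristic b v R ξ) (ha : EllipticPair a b l M L)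
    (hv : LipschitzSemiconcave v K C) (h0 : ξ 0 = x₀) (hp₀ : p₀ ∈ superdiff v x₀)
    (hmin : ∀ p ∈ superdiff v x₀, inner ℝ (a x₀ p₀) p₀ ≤ inner ℝ (a x₀ p) p) :
    Tendsto (slope ξ 0) (𝓝[>] 0) (𝓝 (a x₀ p₀)) := by
  -- Slopes are bounded, so it suffices to identify each ultrafilter limit w = a(x₀)q.
  rw [tendsto_iff_ultrafilter]
  intro g hg
  have hpos : ∀ᶠ s in (g : Filter ℝ), 0 < s := hg self_mem_nhdsWithin
  obtain ⟨w, -, hw⟩ := (isCompact_closedBall (0 : EuclideanSpace ℝ (Fin n)) R).ultrafilter_le_nhds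
    (g.map (slope ξ 0)) (by
      rw [le_principal_iff]
      refine mem_map.2 (mem_of_superset hpos fun s hs => ?_)
      rw [mem_preimage, mem_closedBall_zero_iff]
      exact h.norm_slope_le (ne_of_gt hs))
  have hw : Tendsto (slope ξ 0) g (𝓝 w) := hw
  have hq := h.slope_mem 0 le_rfl g g.neBot hg w hw
  rw [h0] at hq
  set q := b x₀ w with hqdef
  have hwq : w = a x₀ q := (ha.apply_inv _ _).symm
  -- The lower bound for v(ξ(s)) with q meets the semiconcave upper bound with p₀. In the limit ⟨a
  -- q, q⟩ ≤ ⟨p₀, a q⟩, and minimality of p₀ then forces p₀ = q.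
  have hineq : ∀ᶠ s in (g : Filter ℝ), 2 * inner ℝ q (slope ξ 0 s) - inner ℝ (a x₀ q) q
      - L * R * K ^ 2 * s ≤ inner ℝ p₀ (slope ξ 0 s) + C * R ^ 2 * s := by
    filter_upwards [hpos] with s hs
    have h1 := h.lower_bound ha hv h0 (hv.bound _ _ hq) hs.le
    have h2 := hv.le_quadratic _ _ hp₀ (ξ s)
    have h3 : ‖ξ s - x₀‖ ≤ R * s := by
      have := h.lipschitz s 0
      rwa [h0, sub_zero, abs_of_pos hs] at this
    have h4 : C * ‖ξ s - x₀‖ ^ 2 ≤ C * (R * s) ^ 2 := by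
      have := hv.C_nonneg
      gcongr
    have h5 : ξ s - x₀ = s • slope ξ 0 s := by
      rw [slope_def_module, h0, sub_zero, smul_inv_smul₀ hs.ne']
    rw [h5, inner_smul_right] at h1 h2
    have h6 : s * (2 * inner ℝ q (slope ξ 0 s) - inner ℝ (a x₀ q) q - L * R * K ^ 2 * s) ≤
        s * (inner ℝ p₀ (slope ξ 0 s) + C * R ^ 2 * s) := by
      rw [h5] at h4
      linarith
    exact le_of_mul_le_mul_left h6 hs
  have hid : Tendsto (fun s : ℝ => s) g (𝓝 0) := hg.trans nhdsWithin_le_nhds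
  have hc1 : Continuous fun z : EuclideanSpace ℝ (Fin n) × ℝ =>
      2 * inner ℝ q z.1 - inner ℝ (a x₀ q) q - L * R * K ^ 2 * z.2 := by fun_prop
  have hc2 : Continuous fun z : EuclideanSpace ℝ (Fin n) × ℝ =>
      inner ℝ p₀ z.1 + C * R ^ 2 * z.2 := by fun_prop
  have hlim := le_of_tendsto_of_tendsto ((hc1.tendsto (w, 0)).comp (hw.prodMk_nhds hid))
    ((hc2.tendsto (w, 0)).comp (hw.prodMk_nhds hid)) hineq
  simp only [mul_zero, sub_zero, add_zero] at hlim
  have e1 := ha.coercive x₀ (p₀ - q)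
  have e2 : inner ℝ (a x₀ (p₀ - q)) (p₀ - q) = inner ℝ (a x₀ p₀) p₀ - 2 * inner ℝ p₀ w
      + inner ℝ q w := by
    rw [hwq, map_sub, inner_sub_left, inner_sub_right, inner_sub_right, ha.symm x₀ p₀ q,
      real_inner_comm p₀ (a x₀ q), real_inner_comm q (a x₀ q)]
    ring
  have e3 := hmin q hq
  rw [← hwq, real_inner_comm] at hlim e3
  rw [real_inner_comm] at e3
  have e4 : l * ‖p₀ - q‖ ^ 2 ≤ 0 := by
    rw [real_inner_comm w q] at *
    linarith
  have e5 : p₀ - q = 0 := by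
    have := ha.l_pos
    have h7 : ‖p₀ - q‖ ^ 2 ≤ 0 := by
      by_contra hcon
      rw [not_le] at hcon
      have := mul_pos ha.l_pos hcon
      linarith
    exact norm_eq_zero.1 (pow_eq_zero_iff two_ne_zero |>.1 (le_antisymm h7 (sq_nonneg _)))
  rw [sub_eq_zero.1 e5, ← hwq]
  exact hw

/-- The kinetic energy grows at most linearly along a forward characteristic. -/
theorem energy_le (h : IsForwardCharacteristic b v R ξ) (ha : EllipticPair a b l M L)
    (hv : LipschitzSemiconcave v K C) (h0 : ξ 0 = x₀)
    (hslope : Tendsto (slope ξ 0) (𝓝[>] 0) (𝓝 (a x₀ p₀))) {t : ℝ} (ht : 0 ≤ t)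
    {w : EuclideanSpace ℝ (Fin n)} (hw : HasDerivAt ξ w t) :
    inner ℝ (b (ξ t) w) w ≤ inner ℝ (a x₀ p₀) p₀
      + (l⁻¹ * L * l⁻¹ * R + 4 * C + 2 * (l⁻¹ * L * K)) * R ^ 2 * t := by
  have hR := h.nonneg
  have hL := ha.L_nonneg
  have hl := ha.l_pos
  have hK := hv.K_nonneg
  have hC := hv.C_nonneg
  -- The first term comes from differentiating the metric b(ξ); the others are twice the one-sided
  -- Lipschitz estimate `b2`.
  set G := l⁻¹ * L * l⁻¹ * R + 4 * C + 2 * (l⁻¹ * L * K) with hG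
  have hblip : LipschitzWith (Real.toNNReal (l⁻¹ * L * l⁻¹ * R)) fun s => b (ξ s) :=
    LipschitzWith.of_dist_le' fun s t => by
      rw [dist_eq_norm, Real.dist_eq, mul_assoc (l⁻¹ * L * l⁻¹)]
      refine (ha.norm_inv_sub_inv_le _ _).trans ?_
      gcongr
      exact h.lipschitz s t
  -- Compare ξ with its shift by η in the moving metric b(ξ). Dividing by η² and letting η → 0 turns
  -- displacements into velocities.
  have key : ∀ η > 0, inner ℝ (b (ξ t) (ξ (t + η) - ξ t)) (ξ (t + η) - ξ t) ≤
      inner ℝ (b (ξ 0) (ξ (0 + η) - ξ 0)) (ξ (0 + η) - ξ 0) + G * R ^ 2 * η ^ 2 * t := by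
    intro η hη
    have hshift : LipschitzWith (Real.toNNReal R * 1) fun s => ξ (s + η) :=
      h.lipschitzWith.comp (LipschitzWith.of_dist_le_mul fun x y => by simp)
    obtain ⟨K₁, hK₁⟩ := exists_lipschitzOnWith_comp
      (g := fun z : (EuclideanSpace ℝ (Fin n) →L[ℝ] EuclideanSpace ℝ (Fin n)) ×
        EuclideanSpace ℝ (Fin n) × ℝ => inner ℝ (z.1 z.2.1) z.2.1 - G * R ^ 2 * η ^ 2 * z.2.2)
      ((ContDiff.inner ℝ (by fun_prop) (by fun_prop)).sub (by fun_prop))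
      (f := fun σ => (b (ξ σ), ξ (σ + η) - ξ σ, σ)) (a := 0) (b := t)
      (hblip.prodMk ((hshift.sub h.lipschitzWith).prodMk LipschitzWith.id)).lipschitzOnWith
    have hmono := le_of_ae_hasDerivAt_nonpos ht hK₁ (by
      filter_upwards [h.ae_hasDerivAt, hshift.ae_differentiableAt_real,
        hblip.ae_differentiableAt_real] with σ h1 h2 h3 hσ
      obtain ⟨w₁, hw₁⟩ := h1
      have hw₂' : HasDerivAt ξ (deriv (fun s => ξ (s + η)) σ) (σ + η) := by
        have h4 : HasDerivAt (fun s => ξ (s + η)) (deriv (fun s => ξ (s + η)) σ) (σ + η - η) := by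
          rw [add_sub_cancel_right]; exact h2.hasDerivAt
        have h5 := HasDerivAt.comp_sub_const (σ + η) η h4
        simpa using h5
      set w₂ := deriv (fun s => ξ (s + η)) σ with hw₂
      set β := deriv (fun s => b (ξ s)) σ with hβ
      have hd : HasDerivAt (fun s => ξ (s + η) - ξ s) (w₂ - w₁) σ := h2.hasDerivAt.sub hw₁
      set e := ξ (σ + η) - ξ σ with he
      refine ⟨_, ?_, ((h3.hasDerivAt.clm_apply hd).inner ℝ hd).sub
        ((hasDerivAt_id σ).const_mul (G * R ^ 2 * η ^ 2))⟩
      have hp₁ := h.inv_mem_superdiff hσ.1.le hw₁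
      have hp₂ := h.inv_mem_superdiff (by linarith [hσ.1]) hw₂'
      set p₁ := b (ξ σ) w₁ with hp₁d
      set p₂ := b (ξ (σ + η)) w₂ with hp₂d
      have hw₁p : w₁ = a (ξ σ) p₁ := (ha.apply_inv _ _).symm
      have hw₂p : w₂ = a (ξ (σ + η)) p₂ := (ha.apply_inv _ _).symm
      have heR : ‖e‖ ≤ R * η := by
        have := h.lipschitz (σ + η) σ
        rwa [add_sub_cancel_left, abs_of_pos hη] at this
      have b1 : inner ℝ (β e) e ≤ l⁻¹ * L * l⁻¹ * R * ‖e‖ ^ 2 := by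
        have hβn : ‖β‖ ≤ l⁻¹ * L * l⁻¹ * R := by
          have := HasDerivAt.le_of_lipschitz h3.hasDerivAt hblip
          rwa [Real.coe_toNNReal _ (by positivity)] at this
        calc inner ℝ (β e) e ≤ ‖β e‖ * ‖e‖ := real_inner_le_norm _ _
          _ ≤ (l⁻¹ * L * l⁻¹ * R * ‖e‖) * ‖e‖ := by
            gcongr; exact ContinuousLinearMap.le_of_opNorm_le _ hβn e
          _ = _ := by ring
      have b2 : inner ℝ (b (ξ σ) (w₂ - w₁)) e ≤ 2 * C * ‖e‖ ^ 2 + l⁻¹ * L * K * ‖e‖ ^ 2 := by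
        have c1 := (abs_le.1 (ha.abs_inner_inv_apply_sub_le (x := ξ (σ + η)) (y := ξ σ) (w := e)
          (hv.bound _ _ hp₂))).2
        have c2 := hv.inner_sub_le hp₂ hp₁
        rw [← he] at c1 c2
        rw [map_sub, inner_sub_left, ← hp₁d, hw₂p]
        rw [inner_sub_left] at c2
        linarith
      have b3 : inner ℝ (b (ξ σ) e) (w₂ - w₁) = inner ℝ (b (ξ σ) (w₂ - w₁)) e := by
        rw [ha.inv_symm, real_inner_comm]
      have b4 : G * ‖e‖ ^ 2 ≤ G * (R * η) ^ 2 := by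
        gcongr
      rw [inner_add_left, b3, mul_one]
      rw [hG] at b4 ⊢
      linarith)
    simp only [mul_zero, sub_zero] at hmono
    linarith
  have hlim1 : Tendsto (fun η => η⁻¹ • (ξ (t + η) - ξ t)) (𝓝[>] 0) (𝓝 w) :=
    (hasDerivAt_iff_tendsto_slope_zero.1 hw).mono_left
      (nhdsWithin_mono _ fun _ hs => ne_of_gt hs)
  have hlim2 : Tendsto (fun η => η⁻¹ • (ξ (0 + η) - ξ 0)) (𝓝[>] 0) (𝓝 (a x₀ p₀)) := by
    refine hslope.congr fun η => ?_
    rw [slope_def_module, sub_zero, zero_add]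
  have hc : ∀ x, Continuous fun z => inner ℝ (b x z) z := fun x => by fun_prop
  have hle := le_of_tendsto_of_tendsto (((hc (ξ t)).tendsto w).comp hlim1)
    ((((hc (ξ 0)).tendsto (a x₀ p₀)).comp hlim2).add_const (G * R ^ 2 * t)) (by
      filter_upwards [self_mem_nhdsWithin] with η hη
      have hη : 0 < η := hη
      have := key η hη
      simp only [Function.comp_apply, map_smul, inner_smul_left, inner_smul_right, conj_trivial]
      rw [← mul_assoc, ← mul_assoc, ← mul_inv, inv_mul_le_iff₀ (by positivity), mul_add,
        mul_inv_cancel_left₀ (by positivity)]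
      linarith)
  rwa [h0, ha.inv_apply, real_inner_comm (a x₀ p₀) p₀] at hle

end IsForwardCharacteristic

end WeakKAM

/-! ### Persistence of singularities, critical points and the concrete Hamiltonian. -/

namespace WeakKAM

variable {n : ℕ} {v V : EuclideanSpace ℝ (Fin n) → ℝ} {K C l M L R E : ℝ}
  {a b : EuclideanSpace ℝ (Fin n) → EuclideanSpace ℝ (Fin n) →L[ℝ] EuclideanSpace ℝ (Fin n)}
  {ξ : ℝ → EuclideanSpace ℝ (Fin n)} {x₀ p₀ : EuclideanSpace ℝ (Fin n)}

theorem EllipticField.continuous (ha : EllipticField a l M L) : Continuous a :=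
  (LipschitzWith.of_dist_le' (K := L) fun x y => by
    rw [dist_eq_norm, dist_eq_norm]; exact ha.lipschitz x y).continuous

theorem LipschitzSemiconcave.exists_min_energy (hv : LipschitzSemiconcave v K C)
    (a : EuclideanSpace ℝ (Fin n) → EuclideanSpace ℝ (Fin n) →L[ℝ] EuclideanSpace ℝ (Fin n))
    (x : EuclideanSpace ℝ (Fin n)) :
    ∃ p ∈ superdiff v x, ∀ q ∈ superdiff v x, inner ℝ (a x p) p ≤ inner ℝ (a x q) q :=
  (hv.isCompact_superdiff x).exists_isMinOn (hv.nonempty x)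
    (f := fun p => inner ℝ (a x p) p) (by fun_prop)

/-- At a singular point the least energy of a supergradient is strictly below the level. -/
theorem EllipticField.min_energy_lt (ha : EllipticField a l M L) (hx : x₀ ∈ singularSet v)
    (hsub : ∀ p ∈ superdiff v x₀, 1 / 2 * inner ℝ (a x₀ p) p + V x₀ ≤ E)
    (hp₀ : p₀ ∈ superdiff v x₀)
    (hmin : ∀ q ∈ superdiff v x₀, inner ℝ (a x₀ p₀) p₀ ≤ inner ℝ (a x₀ q) q) :
    1 / 2 * inner ℝ (a x₀ p₀) p₀ + V x₀ < E := by
  obtain ⟨q, hq, hne⟩ : ∃ q ∈ superdiff v x₀, q ≠ p₀ := by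
    by_contra! hcon
    exact hx ⟨p₀, Subset.antisymm (fun q hq => hcon q hq) (singleton_subset_iff.2 hp₀)⟩
  -- By the parallelogram identity the midpoint lies strictly below the average energy, so
  -- minimality makes p₀ strictly cheaper than q.
  have hm : (2⁻¹ : ℝ) • p₀ + (2⁻¹ : ℝ) • q ∈ superdiff v x₀ :=
    convex_superdiff x₀ hp₀ hq (by norm_num) (by norm_num) (by norm_num)
  have h1 := hmin _ hm
  have h2 := hsub q hq
  have h3 := hsub p₀ hp₀
  have h4 := ha.coercive x₀ (p₀ - q)
  have h5 : 0 < l * ‖p₀ - q‖ ^ 2 :=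
    mul_pos ha.l_pos (pow_pos (norm_pos_iff.2 (sub_ne_zero.2 hne.symm)) 2)
  simp only [map_add, map_sub, map_smul, inner_add_left, inner_add_right, inner_sub_left,
    inner_sub_right, inner_smul_left, inner_smul_right, conj_trivial] at h1 h4
  linarith

/-- A forward characteristic issuing from a point whose least energy lies strictly below the level
stays singular for a short time. -/
theorem IsForwardCharacteristic.exists_forall_mem_singularSet
    (h : IsForwardCharacteristic b v R ξ) (ha : EllipticPair a b l M L)
    (hv : LipschitzSemiconcave v K C) (h0 : ξ 0 = x₀)
    (hslope : Tendsto (slope ξ 0) (𝓝[>] 0) (𝓝 (a x₀ p₀))) (hV : Continuous V)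
    (hsup : ∀ x, ∀ p ∈ subdiff v x, E ≤ 1 / 2 * inner ℝ (a x p) p + V x)
    (hE : 1 / 2 * inner ℝ (a x₀ p₀) p₀ + V x₀ < E) :
    ∃ τ > 0, ∀ t ∈ Icc (0 : ℝ) τ, ξ t ∈ singularSet v := by
  have hac := ha.continuous
  have hξc := h.lipschitzWith.continuous
  set G := (l⁻¹ * L * l⁻¹ * R + 4 * C + 2 * (l⁻¹ * L * K)) * R ^ 2 with hG
  obtain ⟨E', hE₁, hE₂⟩ := exists_between hE
  have hφ : Continuous fun t => 1 / 2 * (inner ℝ (a x₀ p₀) p₀ + G * t) + V (ξ t) := by fun_prop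
  have hev : ∀ᶠ t in 𝓝 (0 : ℝ), 1 / 2 * (inner ℝ (a x₀ p₀) p₀ + G * t) + V (ξ t) < E' := by
    refine (hφ.tendsto 0).eventually (gt_mem_nhds ?_)
    rw [mul_zero, add_zero, h0]
    exact hE₁
  obtain ⟨ε, hε, hball⟩ := Metric.eventually_nhds_iff.1 hev
  -- Half of ε leaves room for a slightly later time s < ε at which ξ is differentiable.
  refine ⟨ε / 2, half_pos hε, fun t ht => ?_⟩
  rintro ⟨p, hp⟩
  have hEp := hsup _ _ (hv.mem_subdiff_of_superdiff_eq_singleton hp)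
  have hψ : Continuous fun z : EuclideanSpace ℝ (Fin n) × EuclideanSpace ℝ (Fin n) =>
      1 / 2 * inner ℝ (a z.1 z.2) z.2 + V z.1 := by fun_prop
  obtain ⟨ρ, hρ, hψρ⟩ := Metric.eventually_nhds_iff.1
    ((hψ.tendsto (ξ t, p)).eventually (lt_mem_nhds (hE₂.trans_le hEp)))
  have hev2 : ∀ᶠ s in 𝓝 t, (∀ q ∈ superdiff v (ξ s), ‖q - p‖ < ρ) ∧ dist (ξ s) (ξ t) < ρ :=
    (hξc.tendsto t).eventually ((hv.tendsto_of_superdiff_eq_singleton hp hρ).and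
      (Metric.ball_mem_nhds _ hρ))
  obtain ⟨ε', hε', hball'⟩ := Metric.eventually_nhds_iff.1 hev2
  obtain ⟨s, ⟨hs1, hs2⟩, w, hw⟩ := (Measure.dense_of_ae h.ae_hasDerivAt).inter_open_nonempty
    (Ioo t (t + min (ε / 2) ε')) isOpen_Ioo
    (nonempty_Ioo.2 (lt_add_of_pos_right _ (lt_min (half_pos hε) hε')))
  have hs0 : 0 ≤ s := ht.1.trans hs1.le
  have hsε : s < ε := by linarith [min_le_left (ε / 2) ε', ht.2]
  have hst : dist s t < ε' := by
    rw [Real.dist_eq, abs_of_pos (sub_pos.2 hs1)]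
    linarith [min_le_right (ε / 2) ε']
  have hq := h.inv_mem_superdiff hs0 hw
  have h1 := hball' hst
  have h2 : E' < 1 / 2 * inner ℝ (a (ξ s) (b (ξ s) w)) (b (ξ s) w) + V (ξ s) := by
    refine hψρ (y := (ξ s, b (ξ s) w)) ?_
    rw [Prod.dist_eq]
    exact max_lt h1.2 (by rw [dist_eq_norm]; exact h1.1 _ hq)
  rw [ha.apply_inv, real_inner_comm] at h2
  have h3 := h.energy_le ha hv h0 hslope hs0 hw
  have h4 := hball (y := s) (by rw [Real.dist_eq, sub_zero, abs_of_nonneg hs0]; exact hsε)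
  rw [← hG] at h3
  linarith

section Hamiltonian

theorem gradient_quadratic {B : EuclideanSpace ℝ (Fin n) →L[ℝ] EuclideanSpace ℝ (Fin n)}
    (hB : ∀ p q, inner ℝ (B p) q = inner ℝ p (B q)) (k : ℝ) (p : EuclideanSpace ℝ (Fin n)) :
    gradient (fun q => 1 / 2 * inner ℝ (B q) q + k) p = B p := by
  refine HasGradientAt.gradient ?_
  rw [hasGradientAt_iff_hasFDerivAt]
  have h1 := (((B.hasFDerivAt (x := p)).inner ℝ (hasFDerivAt_id p)).const_mul (1 / 2)).add_const k
  refine h1.congr_fderiv ?_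
  ext q
  simp [hB q p, real_inner_comm]
  ring

/-- The closed convex hull in the definition of generalized characteristics is superfluous, since
the Hamiltonian is quadratic and superdifferentials are convex and compact. -/
theorem EllipticPair.mem_closure_convexHull_iff (ha : EllipticPair a b l M L)
    (hv : LipschitzSemiconcave v K C) {x w : EuclideanSpace ℝ (Fin n)} :
    w ∈ closure (convexHull ℝ (a x '' superdiff v x)) ↔ b x w ∈ superdiff v x := by
  have hconv : Convex ℝ (a x '' superdiff v x) :=
    (convex_superdiff x).linear_image (a x).toLinearMap
  have hcl : IsClosed (a x '' superdiff v x) :=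
    ((hv.isCompact_superdiff x).image (a x).continuous).isClosed
  rw [hconv.convexHull_eq, hcl.closure_eq]
  constructor
  · rintro ⟨p, hp, rfl⟩
    rwa [ha.inv_apply]
  · intro h
    exact ⟨_, h, ha.apply_inv _ _⟩

/-- A generalized characteristic issuing from a critical point has no nonzero right derivative. -/
theorem EllipticPair.eq_zero_of_zero_mem_superdiff (ha : EllipticPair a b l M L)
    (hv : LipschitzSemiconcave v K C) {τ : ℝ} (hτ : 0 < τ) {K₁ : ℝ≥0}
    (hlip : LipschitzOnWith K₁ ξ (Icc 0 τ))
    (hinc : ∀ᵐ s, s ∈ Ioo 0 τ → ∃ w, b (ξ s) w ∈ superdiff v (ξ s) ∧ HasDerivAt ξ w s)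
    (h0 : ξ 0 = x₀) (hzero : 0 ∈ superdiff v x₀) {w : EuclideanSpace ℝ (Fin n)}
    (hw : HasDerivWithinAt ξ w (Ici 0) 0) : w = 0 := by
  have hl := ha.l_pos
  have hL := ha.L_nonneg
  have hK := hv.K_nonneg
  have hC := hv.C_nonneg
  have hK₁ : ∀ s ∈ Icc 0 τ, ‖ξ s - x₀‖ ≤ K₁ * s := by
    intro s hs
    have := hlip.dist_le_mul s hs 0 (left_mem_Icc.2 hτ.le)
    rwa [dist_eq_norm, h0, Real.dist_eq, sub_zero, abs_of_nonneg hs.1] at this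
  -- The squared distance to x₀ in the fixed metric b(x₀) has derivative O(‖ξ - x₀‖²), by the
  -- one-sided condition against the supergradient 0. As ‖ξ - x₀‖ ≤ K₁t, integration gives a cubic
  -- bound.
  set G := 2 * (2 * C + l⁻¹ * L * K) * K₁ ^ 2 with hG
  have key : ∀ t ∈ Icc 0 τ, inner ℝ (b x₀ (ξ t - x₀)) (ξ t - x₀) ≤ G * t ^ 3 := by
    intro t ht
    have hlip' : LipschitzOnWith K₁ ξ (Icc 0 t) := hlip.mono (Icc_subset_Icc_right ht.2)
    obtain ⟨K₂, hK₂⟩ := exists_lipschitzOnWith_comp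
      (g := fun z : EuclideanSpace ℝ (Fin n) × ℝ =>
        inner ℝ (b x₀ (z.1 - x₀)) (z.1 - x₀) - G * t ^ 2 * z.2)
      ((ContDiff.inner ℝ (by fun_prop) (by fun_prop)).sub (by fun_prop))
      (f := fun σ => (ξ σ, σ)) (a := 0) (b := t)
      (hlip'.prodMk (LipschitzWith.id.lipschitzOnWith (s := Icc 0 t)))
    have hmono := le_of_ae_hasDerivAt_nonpos ht.1 hK₂ (by
      filter_upwards [hinc] with σ h1 hσ
      obtain ⟨w, hwm, hw⟩ := h1 ⟨hσ.1, hσ.2.trans_le ht.2⟩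
      have hd := hw.sub_const x₀
      have hbd : HasDerivAt (fun s => b x₀ (ξ s - x₀)) (b x₀ w) σ :=
        (b x₀).hasFDerivAt.comp_hasDerivAt σ hd
      refine ⟨_, ?_, (hbd.inner ℝ hd).sub ((hasDerivAt_id σ).const_mul (G * t ^ 2))⟩
      set p := b (ξ σ) w with hp
      set e := ξ σ - x₀ with he
      have hwp : w = a (ξ σ) p := (ha.apply_inv _ _).symm
      have b1 : inner ℝ (b x₀ e) w = inner ℝ (b x₀ w) e := by
        rw [ha.inv_symm, real_inner_comm]
      have c1 := (abs_le.1 (ha.abs_inner_inv_apply_sub_le (x := ξ σ) (y := x₀) (w := e)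
        (hv.bound _ _ hwm))).2
      have c2 := hv.inner_sub_le hwm hzero
      rw [sub_zero, ← he] at c2
      rw [← he, ← hwp] at c1
      have heK : ‖e‖ ≤ K₁ * t := (hK₁ σ ⟨hσ.1.le, hσ.2.le.trans ht.2⟩).trans (by
        have := hσ.2.le
        gcongr)
      have b2 : 2 * (2 * C + l⁻¹ * L * K) * ‖e‖ ^ 2 ≤
          2 * (2 * C + l⁻¹ * L * K) * (K₁ * t) ^ 2 := by gcongr
      rw [b1, mul_one]
      rw [hG]
      linarith)
    rw [h0, sub_self, map_zero, inner_zero_left, mul_zero, sub_zero] at hmono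
    linarith
  have hslope : Tendsto (slope ξ 0) (𝓝[>] 0) (𝓝 w) := by
    have := hasDerivWithinAt_iff_tendsto_slope.1 hw
    rwa [Ici_sdiff_left] at this
  have hc : Continuous fun z => inner ℝ (b x₀ z) z := by fun_prop
  have hid : Tendsto (fun t : ℝ => G * t) (𝓝[>] 0) (𝓝 0) := by
    have : Continuous fun t : ℝ => G * t := by fun_prop
    simpa using (this.tendsto 0).mono_left nhdsWithin_le_nhds
  have hle := le_of_tendsto_of_tendsto ((hc.tendsto w).comp hslope) hid (by
    filter_upwards [Ioc_mem_nhdsGT hτ] with t ht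
    have h1 := key t ⟨ht.1.le, ht.2⟩
    have ht0 := ht.1
    simp only [Function.comp_apply]
    rw [slope_def_module, sub_zero, h0, map_smul, inner_smul_left, inner_smul_right, conj_trivial,
      ← mul_assoc, ← mul_inv, inv_mul_le_iff₀ (by positivity)]
    linarith)
  have h1 := ha.inv_coercive x₀ w
  have h2 : ‖b x₀ w‖ ^ 2 ≤ 0 := by
    by_contra hcon
    rw [not_le] at hcon
    have := mul_pos hl hcon
    linarith
  have h3 : b x₀ w = 0 :=
    norm_eq_zero.1 ((pow_eq_zero_iff two_ne_zero).1 (le_antisymm h2 (sq_nonneg _)))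
  rw [← ha.apply_inv x₀ w, h3, map_zero]

/-- The operators of a periodic smooth field of positive definite matrices form an elliptic pair
with their inverses. -/
theorem exists_ellipticPair {A : EuclideanSpace ℝ (Fin n) → Matrix (Fin n) (Fin n) ℝ}
    (hA : ∀ i j, ContDiff ℝ ∞ (fun x => A x i j)) (hp : ZPeriodic A) (hpos : ∀ x, (A x).PosDef) :
    ∃ l M, ∃ L₀ ≥ 0, ∀ L, L₀ ≤ L → EllipticPair
      (fun x => Matrix.toEuclideanCLM (n := Fin n) (𝕜 := ℝ) (A x))
      (fun x => Matrix.toEuclideanCLM (n := Fin n) (𝕜 := ℝ) (A x)⁻¹) l M L := by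
  set a : EuclideanSpace ℝ (Fin n) → EuclideanSpace ℝ (Fin n) →L[ℝ] EuclideanSpace ℝ (Fin n) :=
    fun x => Matrix.toEuclideanCLM (n := Fin n) (𝕜 := ℝ) (A x) with ha
  have hap : ZPeriodic a := fun k x => by simp only [ha]; rw [hp k x]
  have has : ContDiff ℝ ∞ a := by
    -- Expansion in matrix units turns entrywise smoothness into smoothness in operator norm.
    have e : a = fun x => ∑ i, ∑ j, A x i j •
        Matrix.toEuclideanCLM (n := Fin n) (𝕜 := ℝ) (Matrix.single i j 1) := by
      funext x
      simp only [ha]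
      conv_lhs => rw [Matrix.matrix_eq_sum_single (A x)]
      simp only [map_sum, ← map_smul, Matrix.smul_single, smul_eq_mul, mul_one]
    rw [e]
    exact ContDiff.sum fun i _ => ContDiff.sum fun j _ => (hA i j).smul contDiff_const
  obtain ⟨L₀, hL₀, h1, h2⟩ := hap.exists_second_difference (contDiff_infty.1 has 2)
  obtain ⟨M, hM, hM'⟩ := hap.exists_bound has.continuous
  obtain ⟨l, hl, hl'⟩ := hap.exists_coercive has.continuous (fun x p hp0 => by
    have h := (hpos x).dotProduct_mulVec_pos (x := p.ofLp) (by simpa using hp0)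
    rw [real_inner_comm]
    simp only [ha]
    rw [Matrix.inner_toEuclideanCLM]
    simpa using h)
  refine ⟨l, M, L₀, hL₀, fun L hL => ⟨⟨hl, hM, hL₀.trans hL, fun x p q => ?_, hl', hM',
    fun x y => (h1 x y).trans (by gcongr), fun x y z => (h2 x y z).trans (by gcongr)⟩, ?_, ?_⟩⟩
  · exact Matrix.isSymmetric_toEuclideanLin_iff.2 (hpos x).isHermitian p q
  · intro x p
    have := Matrix.mul_nonsing_inv (A x) ((Matrix.isUnit_iff_isUnit_det _).1 (hpos x).isUnit)
    simp only [ha]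
    rw [← mul_apply_eq_comp, ← map_mul, this, map_one,
      one_apply_eq_self]
  · intro x p
    have := Matrix.nonsing_inv_mul (A x) ((Matrix.isUnit_iff_isUnit_det _).1 (hpos x).isUnit)
    simp only [ha]
    rw [← mul_apply_eq_comp, ← map_mul, this, map_one,
      one_apply_eq_self]

end Hamiltonian

end WeakKAM

/-! ### The two implications. -/

theorem mainTheorem6 {n : ℕ}
    (A : EuclideanSpace ℝ (Fin n) → Matrix (Fin n) (Fin n) ℝ)
    (hA_smooth : ∀ i j, ContDiff ℝ ∞ (fun x => A x i j))
    (hA_periodic : WeakKAM.ZPeriodic A)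
    (hA_posDef : ∀ x, (A x).PosDef)
    (V : EuclideanSpace ℝ (Fin n) → ℝ)
    (hV_smooth : ContDiff ℝ ∞ V)
    (hV_periodic : WeakKAM.ZPeriodic V)
    (c : EuclideanSpace ℝ (Fin n))
    (u : EuclideanSpace ℝ (Fin n) → ℝ)
    (hu : WeakKAM.IsPeriodicViscositySolution (WeakKAM.mechHamiltonian A V) c
      (WeakKAM.matherAlpha (WeakKAM.mechHamiltonian A V) c) u)
    (h_energy : ∀ x, V x < WeakKAM.matherAlpha (WeakKAM.mechHamiltonian A V) c)
    (v : EuclideanSpace ℝ (Fin n) → ℝ)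
    (hv : ∀ x, v x = u x + inner ℝ c x)
    (x₀ : EuclideanSpace ℝ (Fin n))
    (hx₀ : x₀ ∈ WeakKAM.singularSet v) :
    (0 : EuclideanSpace ℝ (Fin n)) ∉ WeakKAM.superdiff v x₀ ↔
      ∃ (τ : ℝ) (ξ : ℝ → EuclideanSpace ℝ (Fin n)), 0 < τ ∧
        WeakKAM.IsSingularGeneralizedCharacteristic (WeakKAM.mechHamiltonian A V) v τ ξ ∧
        ξ 0 = x₀ ∧
        ∃ w : EuclideanSpace ℝ (Fin n), w ≠ 0 ∧ HasDerivWithinAt ξ w (Ici 0) 0 := by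
  open WeakKAM in
  set E := matherAlpha (mechHamiltonian A V) c with hE
  obtain ⟨l, M, L₁, hL₁, hpair⟩ := exists_ellipticPair hA_smooth hA_periodic hA_posDef
  obtain ⟨L₂, -, -, hV₂⟩ :=
    hV_periodic.exists_second_difference (contDiff_infty.1 hV_smooth 2)
  obtain ⟨MV, -, hMV⟩ := hV_periodic.exists_bound hV_smooth.continuous
  -- One constant must control the second differences of both a and V.
  have ha := hpair (max L₁ L₂) (le_max_left _ _)
  set a := fun x => Matrix.toEuclideanCLM (n := Fin n) (𝕜 := ℝ) (A x) with ha_def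
  set b := fun x => Matrix.toEuclideanCLM (n := Fin n) (𝕜 := ℝ) (A x)⁻¹ with hb_def
  have hsub : ∀ x, ∀ p ∈ superdiff v x, 1 / 2 * inner ℝ (a x p) p + V x ≤ E := fun x p hp => by
    have := hu.subsolution x _ ((mem_superdiff_iff_sub_mem hv).1 hp)
    rwa [add_sub_cancel] at this
  have hsup : ∀ x, ∀ p ∈ subdiff v x, E ≤ 1 / 2 * inner ℝ (a x p) p + V x := fun x p hp => by
    have := hu.supersolution x _ ((mem_subdiff_iff_sub_mem hv).1 hp)
    rwa [add_sub_cancel] at this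
  obtain ⟨K, C, hvs⟩ := ha.lipschitzSemiconcave (V := V) (MV := MV) (fun x y z => by
      refine (hV₂ x y z).trans ?_
      gcongr
      exact le_max_right _ _) hMV hu.continuous hu.periodic hv hsub hsup
  have hgrad : ∀ x, (fun p => gradient (mechHamiltonian A V x) p) = a x := fun x =>
    funext fun p => gradient_quadratic (ha.symm x) (V x) p
  constructor
  · intro hzero
    obtain ⟨p₀, hp₀, hmin⟩ := hvs.exists_min_energy a x₀
    obtain ⟨ξ, hξ, h0⟩ := ha.exists_forwardCharacteristic hvs x₀
    have hslope := hξ.tendsto_slope_zero ha hvs h0 hp₀ hmin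
    obtain ⟨τ, hτ, hsing⟩ := hξ.exists_forall_mem_singularSet ha hvs h0 hslope
      hV_smooth.continuous hsup (ha.min_energy_lt hx₀ (hsub x₀) hp₀ hmin)
    refine ⟨τ, ξ, hτ, ⟨⟨⟨_, hξ.lipschitzWith.lipschitzOnWith⟩, ?_⟩, hsing⟩, h0, a x₀ p₀, ?_, ?_⟩
    · rw [ae_restrict_iff' measurableSet_Icc]
      filter_upwards [hξ.ae_hasDerivAt] with s hs hsτ
      obtain ⟨w, hw⟩ := hs
      refine ⟨w, ?_, hw⟩
      rw [hgrad, ha.mem_closure_convexHull_iff hvs]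
      exact hξ.inv_mem_superdiff hsτ.1 hw
    · intro hw
      have : p₀ = 0 := by rw [← ha.inv_apply x₀ p₀, hw, map_zero]
      exact hzero (this ▸ hp₀)
    · rw [hasDerivWithinAt_iff_tendsto_slope, Ici_sdiff_left]
      exact hslope
  · rintro ⟨τ, ξ, hτ, hξ, h0, w, hw0, hw⟩ hzero
    obtain ⟨K₁, hK₁⟩ := hξ.lipschitz
    refine hw0 (ha.eq_zero_of_zero_mem_superdiff hvs hτ hK₁ ?_ h0 hzero hw)
    have := hξ.inclusion
    rw [ae_restrict_iff' measurableSet_Icc] at this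
    filter_upwards [this] with s hs hsτ
    obtain ⟨w, hw, hw'⟩ := hs (Ioo_subset_Icc_self hsτ)
    rw [hgrad, ha.mem_closure_convexHull_iff hvs] at hw
    exact ⟨w, hw, hw'⟩
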